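/- Let $X$ be a non-empty metric space and let $B(x,r)$ denote the closed ball with centre $x$ and radius $r$. For $E\subset X$ and $r>0$, let $N_r(E)$ be the least number of closed balls of radius $r$ (with centres in $X$) required to cover $E$, and let $P_r(E)$ be the maximal cardinality of a subset of $E$ whose distinct points have distance strictly larger than $4r$. For $0<\theta<1$ the *lower spectrum* of $X$ is $$\dim_{\mathrm L}^{\theta}X=\sup\Bigl\{s\ge 0:\exists C>0\ \forall\, 0<r<1\quad \inf_{x\in X}N_r(B(x,r^\theta))\ge C\Bigl(\frac{r^\theta}{r}\Bigr)^{s}\Bigr\}.$$ At $\theta=1$, the expression $(1-\theta)\dim_{\mathrm L}^{\theta}X$ is defined as its limit as $\theta\to1^-$. For real $v\le u$ put $$\underline{\beta}_X(u,v)=\log_2\inf_{x\in X}P_{2^{-u}}(B(x,2^{-v})),\qquad \overline{\beta}_X(u,v)=\log_2\sup_{x\in X}N_{2^{-u}}(B(x,2^{-v})).$$ The space $X$ is called *uniform* if there is a function $\eta\colon\mathbb R\to\mathbb R$ with $\lim_{u\to\infty}\eta(u)/u=0$ and $\overline{\beta}_X(u,v)\le\underline{\beta}_X(u,v)+\eta(u)$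 for all real $v\le u$. **Theorem.** Let $d\in\mathbb N$ and let $\varphi\colon(0,1]\to[0,d]$. Then there is a non-empty uniform set $F\subset\mathbb R^d$ (with the Euclidean metric) such that $(1-\theta)\dim_{\mathrm L}^{\theta}F=\varphi(\theta)$ for all $\theta\in(0,1]$ if and only if $\varphi$ is $d$-Lipschitz and $$\varphi(\theta)\le\varphi(\lambda\theta)-\theta\varphi(\lambda)\qquad\text{for all }\lambda,\theta\in(0,1].$$ Moreover, for $d\ge1$, the class of functions $\varphi\colon(0,1]\to[0,d]$ that satisfy the latter two conditions is a proper subset of the class of functions $\varphi\colon(0,1]\to[0,d]$ that satisfy $$\varphi(\theta)\le\varphi(\lambda\theta)-\theta\varphi(\lambda)\le(1-\theta)d\qquad\text{for all }\lambda,\theta\in(0,1].$$ -/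

import Mathlib

open Set Filter Topology
open scoped NNReal ENNReal

noncomputable section

/-- `N_r(E)`: the least number (in `ℕ∞`) of closed balls of radius `r`, centred in the metric
space `X`, that are required to cover `E ⊆ X`. -/
def coverNum {X : Type*} [MetricSpace X] (r : ℝ≥0) (E : Set X) : ℕ∞ :=
  Metric.externalCoveringNumber r E

/-- `P_r(E)`: the maximal cardinality (in `ℕ∞`) of a subset of `E` any two distinct points of
which have distance strictly larger than `4 r`. -/
def packNum {X : Type*} [MetricSpace X] (r : ℝ≥0) (E : Set X) : ℕ∞ :=
  Metric.packingNumber (4 * r) E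

/-- The logarithm in base `2` of an element of `ℕ∞`, with values in the extended reals. -/
def logTwo (n : ℕ∞) : EReal :=
  ENNReal.log (n : ℝ≥0∞) / ((Real.log 2 : ℝ) : EReal)

/-- The infimal two-scale branching function
`(u, v) ↦ log₂ inf_{x ∈ X} P_{2^{-u}}(B(x, 2^{-v}))`. -/
def lowerBranching (X : Type*) [MetricSpace X] (u v : ℝ) : EReal :=
  logTwo (⨅ x : X, packNum ((2 : ℝ≥0) ^ (-u)) (Metric.closedBall x ((2 : ℝ) ^ (-v))))

/-- The supremal two-scale branching function
`(u, v) ↦ log₂ sup_{x ∈ X} N_{2^{-u}}(B(x, 2^{-v}))`. -/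
def upperBranching (X : Type*) [MetricSpace X] (u v : ℝ) : EReal :=
  logTwo (⨆ x : X, coverNum ((2 : ℝ≥0) ^ (-u)) (Metric.closedBall x ((2 : ℝ) ^ (-v))))

/-- `X` is `η`-uniform: `η(u) / u → 0` as `u → ∞`, and the supremal two-scale branching function
exceeds the infimal one by at most `η(u)`, for all real `v ≤ u`. -/
def IsUniformWith (X : Type*) [MetricSpace X] (η : ℝ → ℝ) : Prop :=
  Tendsto (fun u => u⁻¹ * η u) atTop (𝓝 0) ∧
    ∀ u v : ℝ, v ≤ u → upperBranching X u v ≤ lowerBranching X u v + ((η u : ℝ) : EReal)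

/-- `X` is uniform if it is `η`-uniform for some `η : ℝ → ℝ`. -/
def IsUniformSpaceAtScales (X : Type*) [MetricSpace X] : Prop :=
  ∃ η : ℝ → ℝ, IsUniformWith X η

/-- The `θ`-lower spectrum of `X`, meant for `0 < θ < 1`: the supremum of the `s ≥ 0` for which
there is `C > 0` with `inf_{x ∈ X} N_r(B(x, r^θ)) ≥ C (r^θ / r)^s` for all `0 < r < 1`. -/
def lowerSpectrum (θ : ℝ) (X : Type*) [MetricSpace X] : ℝ≥0∞ :=
  ⨆ s ∈ {s : ℝ≥0 | ∃ C : ℝ, 0 < C ∧ ∀ r : ℝ≥0, 0 < r → r < 1 →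
      ENNReal.ofReal (C * ((r : ℝ) ^ θ / (r : ℝ)) ^ (s : ℝ)) ≤
        ((⨅ x : X, coverNum r (Metric.closedBall x ((r : ℝ) ^ θ)) : ℕ∞) : ℝ≥0∞)},
    (s : ℝ≥0∞)

/-- `(1 - θ) dim_L^θ X = φ(θ)` for all `θ ∈ (0, 1]`, where the value of the left side at `θ = 1` is
by definition its limit as `θ → 1` from below. It is used for `φ` nonnegative on `(0, 1]`. -/
def HasScaledLowerSpectrum (X : Type*) [MetricSpace X] (φ : ℝ → ℝ) : Prop :=
  (∀ θ ∈ Ioo (0 : ℝ) 1, ENNReal.ofReal (1 - θ) * lowerSpectrum θ X = ENNReal.ofReal (φ θ)) ∧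
    Tendsto (fun θ : ℝ => ENNReal.ofReal (1 - θ) * lowerSpectrum θ X) (𝓝[<] 1)
      (𝓝 (ENNReal.ofReal (φ 1)))

/-- The functions `φ : (0, 1] → [0, d]` that are `d`-Lipschitz and satisfy
`φ(θ) ≤ φ(λθ) - θ φ(λ)` for all `λ, θ ∈ (0, 1]`. (Values outside `(0, 1]` play no role.) -/
def classU (d : ℕ) : Set (ℝ → ℝ) :=
  {φ | MapsTo φ (Ioc 0 1) (Icc 0 (d : ℝ)) ∧
    LipschitzOnWith (d : ℝ≥0) φ (Ioc 0 1) ∧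
    ∀ l ∈ Ioc (0 : ℝ) 1, ∀ θ ∈ Ioc (0 : ℝ) 1, φ θ ≤ φ (l * θ) - θ * φ l}

/-- The functions `φ : (0, 1] → [0, d]` that satisfy
`φ(θ) ≤ φ(λθ) - θ φ(λ) ≤ (1 - θ) d` for all `λ, θ ∈ (0, 1]`. (Values outside `(0, 1]` play no
role.) -/
def classH (d : ℕ) : Set (ℝ → ℝ) :=
  {φ | MapsTo φ (Ioc 0 1) (Icc 0 (d : ℝ)) ∧
    ∀ l ∈ Ioc (0 : ℝ) 1, ∀ θ ∈ Ioc (0 : ℝ) 1,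
      φ θ ≤ φ (l * θ) - θ * φ l ∧ φ (l * θ) - θ * φ l ≤ (1 - θ) * d}

end

/-!
Write `u = -log₂ r` and `β(u, v)` for the two-scale branching function. Uniformity makes all balls
of a given size have comparable covering numbers at each smaller scale, so `(1 - θ) dim_L^θ X` is
the lower slope `liminf β(u, θ u) / u`, whether `β` is the lower or the upper branching function.

Necessity: multiplying the numbers of separated points at successive scales gives
`β(u, θ u) + β(θ u, l θ u) ≤ β(u, l θ u) + o(u)`, hence `φ θ + θ φ l ≤ φ (l θ)`; in particular `φ`
is decreasing. Multiplying the sizes of covers gives `φ s ≤ φ t + d (t - s)` for `s ≤ t`, because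
`β(u, v) ≤ d (u - v) + O(1)` in `ℝ^d`.

Sufficiency: let `H` be the pointwise infimum over `n` of suitable vertical translates of
`v ↦ -U φ (v / U)`, `U = (n + 1)!`, with `φ` continued linearly beyond `1`. The inequality for `φ`
gives `H u - H v ≥ u φ (v / u)` for `v ≤ u`, and along `u = (n + 1)!` the two sides with `v = θ u`
differ by at most `d n!`, which is negligible against `u`. The set of points whose binary digits are
free at prescribed positions has branching functions `H u - H v` up to a constant, once the number
of free positions up to scale `u` is close to `H u`.
-/

noncomputable section

/-! ### Profiles -/

/-- A profile with slope bound `d`: the abstract form of the scaled lower spectra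
`θ ↦ (1 - θ) dim_L^θ X` of uniform spaces whose covering numbers grow with exponent at most `d`. -/
structure IsSpectrumProfile (d : ℝ≥0) (φ : ℝ → ℝ) : Prop where
  nonneg : ∀ θ ∈ Ioc (0 : ℝ) 1, 0 ≤ φ θ
  lipschitz : LipschitzOnWith d φ (Ioc 0 1)
  superadd : ∀ l ∈ Ioc (0 : ℝ) 1, ∀ θ ∈ Ioc (0 : ℝ) 1, φ θ ≤ φ (l * θ) - θ * φ l

/-- The extension of `φ` beyond `1` by a linear function of slope `-d`. It is continuous at `1` if
`φ` is a profile, since then `φ 1 = 0`. -/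
def linearExtension (d : ℝ≥0) (φ : ℝ → ℝ) (t : ℝ) : ℝ :=
  φ (min t 1) - d * max (t - 1) 0

lemma le_add_mul_of_lipschitzOnWith {d : ℝ≥0} {φ : ℝ → ℝ} {A : Set ℝ}
    (h : LipschitzOnWith d φ A) {s t : ℝ} (hs : s ∈ A) (ht : t ∈ A) (hst : s ≤ t) :
    φ s ≤ φ t + d * (t - s) := by
  have hdist := h.dist_le_mul s hs t ht
  rw [Real.dist_eq, dist_comm, Real.dist_eq, abs_of_nonneg (sub_nonneg.2 hst)] at hdist
  linarith [le_abs_self (φ s - φ t)]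

lemma linearExtension_of_le_one {d : ℝ≥0} {φ : ℝ → ℝ} {t : ℝ} (ht : t ≤ 1) :
    linearExtension d φ t = φ t := by
  simp [linearExtension, ht]

namespace IsSpectrumProfile

variable {d : ℝ≥0} {φ : ℝ → ℝ} (hφ : IsSpectrumProfile d φ)
include hφ

lemma map_one : φ 1 = 0 := by
  have h := hφ.superadd 1 (by simp) 1 (by simp)
  rw [one_mul, one_mul, sub_self] at h
  exact h.antisymm (hφ.nonneg 1 (by simp))

lemma le_add {s t : ℝ} (hs : 0 < s) (hst : s ≤ t) (ht : t ≤ 1) : φ s ≤ φ t + d * (t - s) :=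
  le_add_mul_of_lipschitzOnWith hφ.lipschitz ⟨hs, hst.trans ht⟩ ⟨hs.trans_le hst, ht⟩ hst

lemma le_mul_one_sub {t : ℝ} (ht : t ∈ Ioc (0 : ℝ) 1) : φ t ≤ d * (1 - t) := by
  simpa [hφ.map_one] using hφ.le_add ht.1 ht.2 le_rfl

lemma linearExtension_of_one_le {t : ℝ} (ht : 1 ≤ t) :
    linearExtension d φ t = -(d * (t - 1)) := by
  simp [linearExtension, ht, hφ.map_one]

lemma linearExtension_le_add {s t : ℝ} (hs : 0 < s) (hst : s ≤ t) :
    linearExtension d φ s ≤ linearExtension d φ t + d * (t - s) := by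
  have h : φ (min s 1) ≤ φ (min t 1) + d * (min t 1 - min s 1) :=
    hφ.le_add (lt_min hs one_pos) (min_le_min_right 1 hst) (min_le_right _ _)
  have hsplit (x : ℝ) : x = min x 1 + max (x - 1) 0 := by
    rcases le_total x 1 with hx | hx <;> simp [hx]
  unfold linearExtension
  linear_combination h - (d : ℝ) * hsplit t + (d : ℝ) * hsplit s

lemma mul_add_linearExtension_le {l θ : ℝ} (hl : 0 < l) (hθ : θ ∈ Ioc (0 : ℝ) 1) :
    l * φ θ + linearExtension d φ l ≤ linearExtension d φ (θ * l) := by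
  have hbound : φ θ ≤ d * (1 - θ) := hφ.le_mul_one_sub hθ
  rcases le_total l 1 with hl1 | hl1
  · rw [linearExtension_of_le_one hl1,
      linearExtension_of_le_one (mul_le_one₀ hθ.2 hl.le hl1)]
    linarith [hφ.superadd θ hθ l ⟨hl, hl1⟩]
  rw [hφ.linearExtension_of_one_le hl1]
  rcases le_total (θ * l) 1 with hθl | hθl
  · rw [linearExtension_of_le_one hθl]
    have hshift : φ θ ≤ φ (θ * l) + d * (θ * l - θ) :=
      hφ.le_add hθ.1 (le_mul_of_one_le_right hθ.1.le hl1) hθl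
    linear_combination hshift + (l - 1) * hbound
  · rw [hφ.linearExtension_of_one_le hθl]
    linear_combination l * hbound

end IsSpectrumProfile

lemma max_zero_one_sub_two_mul_superadd {l θ : ℝ} (hl : l ≤ 1) (hθ : θ ∈ Ioc (0 : ℝ) 1) :
    max 0 (1 - 2 * θ) + θ * max 0 (1 - 2 * l) ≤ max 0 (1 - 2 * (l * θ)) := by
  obtain ⟨hθ0, hθ1⟩ := hθ
  rcases max_cases 0 (1 - 2 * θ) with ⟨eθ, -⟩ | ⟨eθ, -⟩ <;>
  rcases max_cases 0 (1 - 2 * l) with ⟨el, -⟩ | ⟨el, -⟩ <;> rw [eθ, el]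
  · simp
  · exact le_max_of_le_right (by linarith)
  · exact le_max_of_le_right (by linarith [mul_le_of_le_one_left hθ0.le hl])
  · exact le_max_of_le_right (by linarith)

lemma max_zero_one_sub_two_mul_le {l θ : ℝ} (hθ : θ ∈ Ioc (0 : ℝ) 1) :
    max 0 (1 - 2 * (l * θ)) ≤ θ * max 0 (1 - 2 * l) + (1 - θ) := by
  have hmul : θ * (1 - 2 * l) ≤ θ * max 0 (1 - 2 * l) :=
    mul_le_mul_of_nonneg_left (le_max_right _ _) hθ.1.le
  have hnonneg : 0 ≤ θ * max 0 (1 - 2 * l) := mul_nonneg hθ.1.le (le_max_left _ _)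
  exact max_le (by linarith [hθ.2]) (by linarith)

lemma classU_subset_classH (d : ℕ) : classU d ⊆ classH d := by
  rintro φ ⟨hmaps, hlip, hsup⟩
  have hφ : IsSpectrumProfile d φ := ⟨fun θ hθ => (hmaps hθ).1, hlip, hsup⟩
  refine ⟨hmaps, fun l hl θ hθ => ⟨hsup l hl θ hθ, ?_⟩⟩
  have hlθ : φ (l * θ) ≤ φ l + d * (l - l * θ) :=
    hφ.le_add (mul_pos hl.1 hθ.1) (mul_le_of_le_one_right hl.1.le hθ.2) hl.2
  have hl1 : φ l ≤ d * (1 - l) := hφ.le_mul_one_sub hl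
  linear_combination hlθ + mul_le_mul_of_nonneg_left hl1 (sub_nonneg.2 hθ.2)

lemma classU_ssubset_classH {d : ℕ} (hd : 0 < d) : classU d ⊂ classH d := by
  have hd' : (0 : ℝ) < d := Nat.cast_pos.2 hd
  refine (ssubset_iff_of_subset (classU_subset_classH d)).2
    ⟨fun t => d * max 0 (1 - 2 * t), ⟨fun t ht => ⟨by positivity, ?_⟩, fun l hl θ hθ => ?_⟩, ?_⟩
  · exact mul_le_of_le_one_right hd'.le (max_le zero_le_one (by linarith [ht.1]))
  · constructor
    · linear_combination (d : ℝ) * max_zero_one_sub_two_mul_superadd hl.2 hθ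
    · linear_combination (d : ℝ) * max_zero_one_sub_two_mul_le (l := l) hθ
  · -- The slope on `[1/4, 1/2]` is `-2 * d`.
    rintro ⟨-, hlip, -⟩
    have h := le_add_mul_of_lipschitzOnWith hlip (s := 1 / 4) (t := 1 / 2)
      (by norm_num) (by norm_num) (by norm_num)
    norm_num at h
    linarith

/-! ### A one-scale branching function with a given profile -/

/-- The `n`-th piece of `branchingFun`. On `[n!, (n+1)!]` it is a translate of `-U φ(v / U)`, where
`U = (n+1)!`, and beyond `U` it has slope `d`; its value at `n!` is `d n!`. -/
def branchingPiece (d : ℝ≥0) (φ : ℝ → ℝ) (n : ℕ) (v : ℝ) : ℝ :=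
  d * n.factorial + (n + 1).factorial * φ (n.factorial / (n + 1).factorial) -
    (n + 1).factorial * linearExtension d φ (v / (n + 1).factorial)

/-- A one-scale branching function with profile `φ`: the number of binary digits in total that the
points of the realizing set may choose freely down to the scale `2 ^ (-v)`, for `v > 0`. -/
def branchingFun (d : ℝ≥0) (φ : ℝ → ℝ) (v : ℝ) : ℝ :=
  ⨅ n, branchingPiece d φ n v

lemma branchingPiece_factorial (d : ℝ≥0) (φ : ℝ → ℝ) (n : ℕ) :
    branchingPiece d φ n n.factorial = d * n.factorial := by
  have hU : (0 : ℝ) < (n + 1).factorial := Nat.cast_pos.2 (n + 1).factorial_pos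
  have hle : (n.factorial : ℝ) ≤ (n + 1).factorial := by exact_mod_cast Nat.factorial_le n.le_succ
  rw [branchingPiece, linearExtension_of_le_one (div_le_one_of_le₀ hle hU.le)]
  ring

namespace IsSpectrumProfile

variable {d : ℝ≥0} {φ : ℝ → ℝ} (hφ : IsSpectrumProfile d φ)
include hφ

lemma branchingPiece_le_add (n : ℕ) {v u : ℝ} (hv : 0 < v) (hvu : v ≤ u) :
    branchingPiece d φ n u ≤ branchingPiece d φ n v + d * (u - v) := by
  have hU : (0 : ℝ) < (n + 1).factorial := Nat.cast_pos.2 (n + 1).factorial_pos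
  have h := hφ.linearExtension_le_add (div_pos hv hU) (div_le_div_of_nonneg_right hvu hU.le)
  unfold branchingPiece
  rw [← sub_div, ← mul_div_assoc] at h
  linear_combination (norm := skip) ((n + 1).factorial : ℝ) * h
  field_simp
  linarith

lemma mul_le_branchingPiece_sub (n : ℕ) {v u : ℝ} (hv : 0 < v) (hvu : v ≤ u) :
    u * φ (v / u) ≤ branchingPiece d φ n u - branchingPiece d φ n v := by
  have hU : (0 : ℝ) < (n + 1).factorial := Nat.cast_pos.2 (n + 1).factorial_pos
  have hu : 0 < u := hv.trans_le hvu
  have h := hφ.mul_add_linearExtension_le (div_pos hu hU)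
    (θ := v / u) ⟨div_pos hv hu, div_le_one_of_le₀ hvu hu.le⟩
  rw [div_mul_div_cancel₀ hu.ne'] at h
  unfold branchingPiece
  linear_combination (norm := skip) ((n + 1).factorial : ℝ) * h
  field_simp
  linarith

lemma branchingPiece_mono (n : ℕ) {v u : ℝ} (hv : 0 < v) (hvu : v ≤ u) :
    branchingPiece d φ n v ≤ branchingPiece d φ n u := by
  have hu : 0 < u := hv.trans_le hvu
  have hφvu : 0 ≤ φ (v / u) := hφ.nonneg _ ⟨div_pos hv hu, div_le_one_of_le₀ hvu hu.le⟩
  linarith [hφ.mul_le_branchingPiece_sub n hv hvu, mul_nonneg hu.le hφvu]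

lemma mul_le_branchingPiece (n : ℕ) {v : ℝ} (hv : 0 < v) (hvn : v ≤ n.factorial) :
    d * v ≤ branchingPiece d φ n v := by
  have h := hφ.branchingPiece_le_add n hv hvn
  rw [branchingPiece_factorial] at h
  linarith

lemma branchingPiece_nonneg (n : ℕ) {v : ℝ} (hv : 0 < v) : 0 ≤ branchingPiece d φ n v := by
  rcases le_total v n.factorial with hvn | hvn
  · exact le_trans (by positivity) (hφ.mul_le_branchingPiece n hv hvn)
  · have h := hφ.branchingPiece_mono n (Nat.cast_pos.2 n.factorial_pos) hvn
    rw [branchingPiece_factorial] at h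
    exact le_trans (by positivity) h

lemma mul_sub_factorial_le_branchingPiece (n : ℕ) {v : ℝ} (hv : (n + 1).factorial ≤ v) :
    d * (v - (n + 1).factorial) ≤ branchingPiece d φ n v := by
  have hn : (0 : ℝ) < n.factorial := Nat.cast_pos.2 n.factorial_pos
  have hU : (0 : ℝ) < (n + 1).factorial := Nat.cast_pos.2 (n + 1).factorial_pos
  have hle : (n.factorial : ℝ) ≤ (n + 1).factorial := by exact_mod_cast Nat.factorial_le n.le_succ
  have hφn : 0 ≤ φ (n.factorial / (n + 1).factorial) :=
    hφ.nonneg _ ⟨div_pos hn hU, div_le_one_of_le₀ hle hU.le⟩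
  have hmul : (n + 1).factorial * (v / (n + 1).factorial) = v := mul_div_cancel₀ v hU.ne'
  rw [branchingPiece, hφ.linearExtension_of_one_le ((one_le_div hU).2 hv)]
  linear_combination mul_nonneg d.coe_nonneg hn.le + mul_nonneg hU.le hφn - (d : ℝ) * hmul

lemma branchingPiece_sub_le (m n : ℕ) {v : ℝ} (hnv : n.factorial ≤ v)
    (hvn : v ≤ (n + 1).factorial) :
    branchingPiece d φ n v - d * n.factorial ≤ branchingPiece d φ m v := by
  have hn : (0 : ℝ) < n.factorial := Nat.cast_pos.2 n.factorial_pos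
  have hpiece : branchingPiece d φ n v ≤ d * v := by
    have h := hφ.branchingPiece_le_add n hn hnv
    rw [branchingPiece_factorial] at h
    linarith
  rcases lt_trichotomy m n with hmn | rfl | hnm
  · have hfac : ((m + 1).factorial : ℝ) ≤ n.factorial := by exact_mod_cast Nat.factorial_le hmn
    linear_combination hpiece + (d : ℝ) * hfac +
      hφ.mul_sub_factorial_le_branchingPiece m (hfac.trans hnv)
  · exact sub_le_self _ (by positivity)
  · have hfac : ((n + 1).factorial : ℝ) ≤ m.factorial := by exact_mod_cast Nat.factorial_le hnm
    have hm := hφ.mul_le_branchingPiece m (hn.trans_le hnv) (hvn.trans hfac)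
    linarith [mul_nonneg d.coe_nonneg hn.le]

lemma bddBelow_branchingPiece {v : ℝ} (hv : 0 < v) :
    BddBelow (range fun n => branchingPiece d φ n v) :=
  ⟨0, forall_mem_range.2 fun n => hφ.branchingPiece_nonneg n hv⟩

lemma branchingFun_le_add {v u c : ℝ} (hv : 0 < v)
    (h : ∀ n, branchingPiece d φ n v ≤ branchingPiece d φ n u + c) :
    branchingFun d φ v ≤ branchingFun d φ u + c :=
  sub_le_iff_le_add.1 <| le_ciInf fun n =>
    sub_le_iff_le_add.2 <| (ciInf_le (hφ.bddBelow_branchingPiece hv) n).trans (h n)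

lemma branchingFun_le_add_mul {v u : ℝ} (hv : 0 < v) (hvu : v ≤ u) :
    branchingFun d φ u ≤ branchingFun d φ v + d * (u - v) :=
  hφ.branchingFun_le_add (hv.trans_le hvu) fun n => hφ.branchingPiece_le_add n hv hvu

lemma mul_le_branchingFun_sub {v u : ℝ} (hv : 0 < v) (hvu : v ≤ u) :
    u * φ (v / u) ≤ branchingFun d φ u - branchingFun d φ v := by
  have h : branchingFun d φ v ≤ branchingFun d φ u + -(u * φ (v / u)) :=
    hφ.branchingFun_le_add hv fun n => by linarith [hφ.mul_le_branchingPiece_sub n hv hvu]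
  linarith

lemma branchingFun_mono {v u : ℝ} (hv : 0 < v) (hvu : v ≤ u) :
    branchingFun d φ v ≤ branchingFun d φ u := by
  have hu : 0 < u := hv.trans_le hvu
  have hφvu : 0 ≤ φ (v / u) := hφ.nonneg _ ⟨div_pos hv hu, div_le_one_of_le₀ hvu hu.le⟩
  linarith [hφ.mul_le_branchingFun_sub hv hvu, mul_nonneg hu.le hφvu]

lemma branchingFun_factorial_sub_le (n : ℕ) {θ : ℝ} (hθ : θ ≤ 1) (hn : 1 ≤ θ * (n + 1)) :
    branchingFun d φ (n + 1).factorial - branchingFun d φ (θ * (n + 1).factorial) ≤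
      (n + 1).factorial * φ θ + d * n.factorial := by
  set U : ℝ := ((n + 1).factorial : ℝ) with hU_def
  have hU : 0 < U := Nat.cast_pos.2 (n + 1).factorial_pos
  have hUn : U = (n + 1) * n.factorial := by simp [hU_def, Nat.factorial_succ]
  have hnθ : n.factorial ≤ θ * U := by
    rw [hUn, ← mul_assoc]
    exact le_mul_of_one_le_left (Nat.cast_nonneg _) hn
  have hfU : branchingFun d φ U ≤ branchingPiece d φ n U :=
    ciInf_le (hφ.bddBelow_branchingPiece hU) n
  have hfθ : branchingPiece d φ n (θ * U) - d * n.factorial ≤ branchingFun d φ (θ * U) :=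
    le_ciInf fun m => hφ.branchingPiece_sub_le m n hnθ (mul_le_of_le_one_left hU.le hθ)
  have hdiff : branchingPiece d φ n U - branchingPiece d φ n (θ * U) = U * φ θ := by
    simp only [branchingPiece, ← hU_def, div_self hU.ne', mul_div_cancel_right₀ θ hU.ne',
      linearExtension_of_le_one le_rfl, linearExtension_of_le_one hθ, hφ.map_one]
    ring
  linarith

end IsSpectrumProfile

/-! ### Covering and packing numbers -/

lemma iSup_natCast_le_eq (a : ℕ∞) : ⨆ m : {m : ℕ // (m : ℕ∞) ≤ a}, (m : ℕ∞) = a :=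
  le_antisymm (iSup_le Subtype.prop) <| ENat.forall_natCast_le_iff_le.1 fun m hm =>
    le_iSup_of_le ⟨m, hm⟩ le_rfl

lemma enat_mul_le_of_forall_natCast_le {a b c : ℕ∞}
    (h : ∀ m n : ℕ, (m : ℕ∞) ≤ a → (n : ℕ∞) ≤ b → ((m * n : ℕ) : ℕ∞) ≤ c) : a * b ≤ c := by
  rw [← iSup_natCast_le_eq a, ← iSup_natCast_le_eq b, ENat.iSup_mul]
  refine iSup_le fun m => ?_
  rw [ENat.mul_iSup]
  exact iSup_le fun n => by simpa using h m n m.2 n.2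

lemma enat_le_mul_of_forall_le_natCast {a b c : ℕ∞} (ha : a ≠ 0) (hb : b ≠ 0)
    (h : ∀ m n : ℕ, a ≤ m → b ≤ n → c ≤ ((m * n : ℕ) : ℕ∞)) : c ≤ a * b := by
  cases a with
  | top => simp [ENat.top_mul hb]
  | coe m =>
    cases b with
    | top => simp [ENat.mul_top ha]
    | coe n => simpa using h m n le_rfl le_rfl

section LogTwo

lemma ereal_log_two_pos : (0 : EReal) < (Real.log 2 : ℝ) :=
  EReal.coe_pos.2 (Real.log_pos one_lt_two)

lemma logTwo_mono : Monotone logTwo := fun _ _ h =>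
  EReal.div_le_div_right_of_nonneg ereal_log_two_pos.le
    (ENNReal.log_monotone (ENat.toENNReal_le.2 h))

lemma logTwo_mul (m n : ℕ∞) : logTwo (m * n) = logTwo m + logTwo n := by
  simp only [logTwo, ENat.toENNReal_mul, ENNReal.log_mul_add]
  exact EReal.add_div_of_nonneg_right ereal_log_two_pos.le

lemma logTwo_one : logTwo 1 = 0 := by
  simp [logTwo]

lemma logTwo_nonneg {n : ℕ∞} (hn : n ≠ 0) : 0 ≤ logTwo n :=
  logTwo_one.symm.trans_le (logTwo_mono (Order.one_le_iff_ne_zero.2 hn))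

lemma log_ofReal_two_rpow (a : ℝ) :
    ENNReal.log (ENNReal.ofReal (2 ^ a)) = (a : EReal) * (Real.log 2 : ℝ) := by
  rw [ENNReal.log_ofReal_of_pos (by positivity), Real.log_rpow two_pos, EReal.coe_mul]

lemma coe_le_logTwo_iff {a : ℝ} {n : ℕ∞} :
    (a : EReal) ≤ logTwo n ↔ ENNReal.ofReal (2 ^ a) ≤ n := by
  rw [logTwo, EReal.le_div_iff_mul_le ereal_log_two_pos (EReal.coe_ne_top _),
    ← log_ofReal_two_rpow, ENNReal.log_le_log_iff]

lemma logTwo_le_coe_iff {a : ℝ} {n : ℕ∞} :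
    logTwo n ≤ a ↔ (n : ℝ≥0∞) ≤ ENNReal.ofReal (2 ^ a) := by
  rw [logTwo, EReal.div_le_iff_le_mul ereal_log_two_pos (EReal.coe_ne_top _), mul_comm,
    ← log_ofReal_two_rpow, ENNReal.log_le_log_iff]

lemma logTwo_natCast_le_coe {n : ℕ} {a : ℝ} (h : (n : ℝ) ≤ 2 ^ a) : logTwo n ≤ a :=
  logTwo_le_coe_iff.2 (by simpa using ENNReal.ofReal_le_ofReal h)

lemma coe_le_logTwo_natCast {n : ℕ} {a : ℝ} (h : 2 ^ a ≤ (n : ℝ)) : (a : EReal) ≤ logTwo n :=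
  coe_le_logTwo_iff.2 (by simpa using ENNReal.ofReal_le_ofReal h)

end LogTwo

section Metric

variable {X : Type*} [MetricSpace X] {r ρ : ℝ≥0} {A : Set X}

lemma edist_le_coe_iff {x y : X} : edist x y ≤ r ↔ dist x y ≤ r := by
  rw [edist_nndist, ENNReal.coe_le_coe, ← NNReal.coe_le_coe, coe_nndist]

lemma coe_lt_edist_iff {x y : X} : (r : ℝ≥0∞) < edist x y ↔ r < dist x y := by
  rw [edist_nndist, ENNReal.coe_lt_coe, ← NNReal.coe_lt_coe, coe_nndist]

lemma coverNum_le_card (C : Finset X) (hC : ∀ x ∈ A, ∃ y ∈ C, dist x y ≤ r) :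
    coverNum r A ≤ C.card := by
  have hcover : Metric.IsCover r A (C : Set X) := fun x hx =>
    let ⟨y, hy, hxy⟩ := hC x hx
    ⟨y, hy, edist_le_coe_iff.2 hxy⟩
  simpa [coverNum] using hcover.externalCoveringNumber_le_encard

lemma exists_finset_cover_of_coverNum_le {m : ℕ} (h : coverNum r A ≤ m) :
    ∃ C : Finset X, C.card ≤ m ∧ ∀ x ∈ A, ∃ y ∈ C, dist x y ≤ r := by
  have hlt : coverNum r A < (m + 1 : ℕ) := h.trans_lt (by exact_mod_cast m.lt_succ_self)
  simp only [coverNum, Metric.externalCoveringNumber, iInf_lt_iff] at hlt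
  obtain ⟨C, hC, hCm⟩ := hlt
  lift C to Finset X using Set.finite_of_encard_le_coe hCm.le
  rw [Set.encard_coe_eq_coe_finsetCard, Nat.cast_lt, Nat.lt_succ_iff] at hCm
  refine ⟨C, hCm, fun x hx => ?_⟩
  obtain ⟨y, hy, hxy⟩ := hC hx
  exact ⟨y, hy, edist_le_coe_iff.1 hxy⟩

/-- Points with equal codes are within distance `r`, so one point per code is enough for a
cover. -/
lemma coverNum_le_card_of_code {ι : Type*} (code : X → ι) (S : Finset ι)
    (hS : ∀ x ∈ A, code x ∈ S)
    (hcode : ∀ x ∈ A, ∀ y ∈ A, code x = code y → dist x y ≤ r) : coverNum r A ≤ S.card := by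
  classical
  let T : Finset ι := {i ∈ S | ∃ x ∈ A, code x = i}
  have hT : ∀ i : T, ∃ x ∈ A, code x = i := fun i => (Finset.mem_filter.1 i.2).2
  choose rep hrepA hrep using hT
  refine (coverNum_le_card (T.attach.image rep) fun x hx => ?_).trans ?_
  · have hxT : code x ∈ T := Finset.mem_filter.2 ⟨hS x hx, x, hx, rfl⟩
    exact ⟨rep ⟨_, hxT⟩, Finset.mem_image_of_mem _ (Finset.mem_attach _ _),
      hcode _ hx _ (hrepA _) (hrep ⟨_, hxT⟩).symm⟩
  · rw [Nat.cast_le]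
    calc (T.attach.image rep).card ≤ T.attach.card := Finset.card_image_le
      _ = T.card := Finset.card_attach
      _ ≤ S.card := Finset.card_filter_le _ _

lemma coverNum_le_mul {m n : ℕ} (hm : coverNum ρ A ≤ m)
    (hn : ∀ y : X, coverNum r (Metric.closedBall y ρ) ≤ n) : coverNum r A ≤ (m * n : ℕ) := by
  classical
  obtain ⟨C, hCm, hC⟩ := exists_finset_cover_of_coverNum_le hm
  choose D hDn hD using fun y => exists_finset_cover_of_coverNum_le (hn y)
  refine (coverNum_le_card (C.biUnion D) fun x hx => ?_).trans ?_
  · obtain ⟨y, hy, hxy⟩ := hC x hx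
    obtain ⟨z, hz, hxz⟩ := hD y x hxy
    exact ⟨z, Finset.mem_biUnion.2 ⟨y, hy, hz⟩, hxz⟩
  · exact Nat.cast_le.2 ((Finset.card_biUnion_le_card_mul _ _ _ fun y _ => hDn y).trans
      (Nat.mul_le_mul_right _ hCm))

lemma card_le_packNum (C : Finset X) (hCA : ∀ x ∈ C, x ∈ A)
    (hC : ∀ x ∈ C, ∀ y ∈ C, x ≠ y → 4 * (r : ℝ) < dist x y) : C.card ≤ packNum r A := by
  have hsep : Metric.IsSeparated ((4 * r : ℝ≥0) : ℝ≥0∞) (C : Set X) := fun x hx y hy hxy =>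
    coe_lt_edist_iff.2 (by simpa using hC x hx y hy hxy)
  simpa [packNum] using hsep.encard_le_packingNumber (A := A) hCA

lemma card_le_packNum_of_family {ι : Type*} [Fintype ι] (c : ι → X) (hcA : ∀ i, c i ∈ A)
    (hc : ∀ i j, i ≠ j → 4 * (r : ℝ) < dist (c i) (c j)) : Fintype.card ι ≤ packNum r A := by
  classical
  have hinj : Function.Injective c := fun i j hij => by
    by_contra hne
    have hlt := hc i j hne
    rw [hij, dist_self] at hlt
    exact hlt.not_ge (by positivity)
  rw [← Finset.card_univ, ← Finset.card_image_of_injective _ hinj]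
  exact card_le_packNum _ (Finset.forall_mem_image.2 fun i _ => hcA i)
    (Finset.forall_mem_image.2 fun i _ => Finset.forall_mem_image.2 fun j _ hij =>
      hc i j (ne_of_apply_ne c hij))

lemma exists_finset_separated_of_le_packNum {m : ℕ} (h : m ≤ packNum r A) :
    ∃ C : Finset X, C.card = m ∧ (∀ x ∈ C, x ∈ A) ∧
      ∀ x ∈ C, ∀ y ∈ C, x ≠ y → 4 * (r : ℝ) < dist x y := by
  rcases m with _ | m
  · exact ⟨∅, by simp⟩
  have hlt : (m : ℕ∞) < packNum r A := lt_of_lt_of_le (by exact_mod_cast m.lt_succ_self) h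
  simp only [packNum, Metric.packingNumber, lt_iSup_iff] at hlt
  obtain ⟨C, hCA, hC, hmC⟩ := hlt
  obtain ⟨D, hDC, hD⟩ := Set.exists_subset_encard_eq (k := ((m + 1 : ℕ) : ℕ∞))
    (by simpa using Order.add_one_le_of_lt hmC)
  lift D to Finset X using Set.finite_of_encard_eq_coe hD
  rw [Set.encard_coe_eq_coe_finsetCard, Nat.cast_inj] at hD
  refine ⟨D, hD, fun x hx => hCA (hDC hx), fun x hx y hy hxy => ?_⟩
  simpa using coe_lt_edist_iff.1 (hC (hDC hx) (hDC hy) hxy)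

lemma mul_le_packNum {x : X} {R S : ℝ} {m n : ℕ} (hr : 2 * r ≤ ρ) (hS : R + ρ ≤ S)
    (hm : m ≤ packNum ρ (Metric.closedBall x R))
    (hn : ∀ y : X, n ≤ packNum r (Metric.closedBall y ρ)) :
    (m * n : ℕ) ≤ packNum r (Metric.closedBall x S) := by
  classical
  obtain ⟨C, hCm, hCR, hC⟩ := exists_finset_separated_of_le_packNum hm
  choose D hDn hDρ hD using fun y => exists_finset_separated_of_le_packNum (hn y)
  have hr' : 2 * (r : ℝ) ≤ ρ := by exact_mod_cast hr
  have hsep : ∀ y ∈ C, ∀ z ∈ C, y ≠ z → ∀ a ∈ D y, ∀ b ∈ D z, 4 * (r : ℝ) < dist a b := by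
    intro y hy z hz hyz a ha b hb
    have hay : dist y a ≤ ρ := Metric.mem_closedBall'.1 (hDρ y a ha)
    have hbz : dist b z ≤ ρ := Metric.mem_closedBall.1 (hDρ z b hb)
    linarith [hC y hy z hz hyz, dist_triangle4 y a b z, hr']
  have hdisj : (C : Set X).PairwiseDisjoint D := fun y hy z hz hyz =>
    Finset.disjoint_left.2 fun a hay haz => by
      have h := hsep y hy z hz hyz a hay a haz
      rw [dist_self] at h
      linarith [r.coe_nonneg]
  have hcard : (C.biUnion D).card = m * n := by
    rw [Finset.card_biUnion hdisj, Finset.sum_congr rfl fun y _ => hDn y, Finset.sum_const, hCm,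
      smul_eq_mul]
  rw [← hcard]
  refine card_le_packNum _ (fun a ha => ?_) fun a ha b hb hab => ?_
  · obtain ⟨y, hy, hay⟩ := Finset.mem_biUnion.1 ha
    exact Metric.closedBall_subset_closedBall' (by linarith [Metric.mem_closedBall.1 (hCR y hy)])
      (hDρ y a hay)
  · obtain ⟨y, hy, hay⟩ := Finset.mem_biUnion.1 ha
    obtain ⟨z, hz, hbz⟩ := Finset.mem_biUnion.1 hb
    rcases eq_or_ne y z with rfl | hyz
    · exact hD y a hay b hbz hab
    · exact hsep y hy z hz hyz a hay b hbz

lemma packNum_le_coverNum (r : ℝ≥0) (A : Set X) : packNum r A ≤ coverNum r A := by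
  refine le_trans ?_ (Metric.packingNumber_two_mul_le_externalCoveringNumber r A)
  refine iSup_mono fun C => iSup_mono fun _ => iSup_mono' fun hC => ⟨hC.anti ?_, le_rfl⟩
  rw [ENNReal.coe_le_coe]
  gcongr
  norm_num

end Metric

section Branching

variable {X : Type*} [MetricSpace X]

variable (X) in
/-- The infimal two-scale covering function
`(u, v) ↦ log₂ inf_{x ∈ X} N_{2^{-u}}(B(x, 2^{-v}))`, which the lower spectrum refers to. It lies
between the infimal and the supremal branching functions. -/
def lowerCovering (u v : ℝ) : EReal :=
  logTwo (⨅ x : X, coverNum ((2 : ℝ≥0) ^ (-u)) (Metric.closedBall x ((2 : ℝ) ^ (-v))))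

lemma lowerBranching_le_lowerCovering (u v : ℝ) : lowerBranching X u v ≤ lowerCovering X u v :=
  logTwo_mono (iInf_mono fun _ => packNum_le_coverNum _ _)

lemma lowerCovering_le_upperBranching [Nonempty X] (u v : ℝ) :
    lowerCovering X u v ≤ upperBranching X u v :=
  logTwo_mono iInf_le_iSup

lemma coverNum_closedBall_ne_zero (r : ℝ≥0) (x : X) {R : ℝ} (hR : 0 ≤ R) :
    coverNum r (Metric.closedBall x R) ≠ 0 :=
  (Metric.externalCoveringNumber_pos_iff.2 ⟨x, Metric.mem_closedBall_self hR⟩).ne'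

lemma lowerBranching_nonneg (u v : ℝ) : 0 ≤ lowerBranching X u v :=
  logTwo_nonneg fun h =>
    let ⟨x, hx⟩ := ENat.iInf_eq_zero.1 h
    (Metric.packingNumber_pos_iff.2 ⟨x, Metric.mem_closedBall_self (by positivity)⟩).ne' hx

lemma lowerCovering_nonneg (u v : ℝ) : 0 ≤ lowerCovering X u v :=
  (lowerBranching_nonneg u v).trans (lowerBranching_le_lowerCovering u v)

lemma two_mul_two_rpow_neg_le {a b : ℝ} (hab : b + 1 ≤ a) : 2 * (2 : ℝ) ^ (-a) ≤ 2 ^ (-b) :=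
  calc 2 * (2 : ℝ) ^ (-a) = 2 ^ (1 + -a) := by rw [Real.rpow_add two_pos, Real.rpow_one]
    _ ≤ 2 ^ (-b) := Real.rpow_le_rpow_of_exponent_le one_le_two (by linarith)

lemma upperBranching_le_add [Nonempty X] (u v w : ℝ) :
    upperBranching X u w ≤ upperBranching X v w + upperBranching X u v := by
  have hne (a b : ℝ) :
      ⨆ x : X, coverNum ((2 : ℝ≥0) ^ (-a)) (Metric.closedBall x ((2 : ℝ) ^ (-b))) ≠ 0 := fun h =>
    have x : X := Classical.arbitrary X
    coverNum_closedBall_ne_zero _ x (by positivity) (ENat.iSup_eq_zero.1 h x)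
  unfold upperBranching
  rw [← logTwo_mul]
  refine logTwo_mono <| enat_le_mul_of_forall_le_natCast (hne v w) (hne u v) fun m n hm hn =>
    iSup_le fun x => coverNum_le_mul (ρ := 2 ^ (-v)) ((le_iSup _ x).trans hm) fun y => ?_
  simpa using (le_iSup _ y).trans hn

lemma add_le_lowerBranching {u v w : ℝ} (hwv : w + 1 ≤ v) (hvu : v + 1 ≤ u) :
    lowerBranching X v (w + 1) + lowerBranching X u v ≤ lowerBranching X u w := by
  have hscale : (2 : ℝ≥0) * 2 ^ (-u) ≤ 2 ^ (-v) := by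
    exact_mod_cast two_mul_two_rpow_neg_le hvu
  have hradius : (2 : ℝ) ^ (-(w + 1)) + ((2 ^ (-v) : ℝ≥0) : ℝ) ≤ 2 ^ (-w) := by
    have hle : (2 : ℝ) ^ (-v) ≤ 2 ^ (-(w + 1)) :=
      Real.rpow_le_rpow_of_exponent_le one_le_two (neg_le_neg hwv)
    push_cast
    linarith [two_mul_two_rpow_neg_le (le_refl (w + 1))]
  unfold lowerBranching
  rw [← logTwo_mul]
  refine logTwo_mono <| enat_mul_le_of_forall_natCast_le fun m n hm hn => le_iInf fun x =>
    mul_le_packNum hscale hradius (hm.trans (iInf_le _ x)) fun y => ?_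
  simpa using hn.trans (iInf_le _ y)

end Branching

/-! ### Lower growth rates and the lower spectrum -/

section LowerSlope

variable {A B : ℝ → EReal}

/-- The lower linear growth rate `liminf_{u → ∞} A u / u`. Up to the factor `1 - θ`, the lower
spectrum is the growth rate of the two-scale covering function along `v = θ u`. -/
def lowerSlope (A : ℝ → EReal) : EReal :=
  liminf (fun u => A u / u) atTop

lemma le_lowerSlope {c : ℝ} (h : ∀ᶠ u in atTop, ((c * u : ℝ) : EReal) ≤ A u) :
    c ≤ lowerSlope A := by
  refine le_liminf_of_le (by isBoundedDefault) ?_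
  filter_upwards [h, eventually_gt_atTop 0] with u hu hu0
  rwa [EReal.le_div_iff_mul_le (EReal.coe_pos.2 hu0) (EReal.coe_ne_top _), ← EReal.coe_mul]

lemma eventually_le_of_lt_lowerSlope {c : ℝ} (h : c < lowerSlope A) :
    ∀ᶠ u in atTop, ((c * u : ℝ) : EReal) ≤ A u := by
  filter_upwards [eventually_lt_of_lt_liminf h, eventually_gt_atTop 0] with u hu hu0
  rw [EReal.lt_div_iff (EReal.coe_pos.2 hu0) (EReal.coe_ne_top _), ← EReal.coe_mul] at hu
  exact hu.le

lemma lowerSlope_le_add {E : ℝ → ℝ} {c : ℝ} (hE : Tendsto (fun u => E u / u) atTop (𝓝 c))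
    (h : ∀ᶠ u in atTop, A u ≤ B u + (E u : EReal)) : lowerSlope A ≤ c + lowerSlope B := by
  have hlim : limsup (fun u => ((E u / u : ℝ) : EReal)) atTop = c :=
    ((continuous_coe_real_ereal.tendsto c).comp hE).limsup_eq
  calc lowerSlope A
      ≤ liminf ((fun u => ((E u / u : ℝ) : EReal)) + fun u => B u / u) atTop := by
        refine liminf_le_liminf ?_
        filter_upwards [h, eventually_ge_atTop 0] with u hu hu0
        refine (EReal.div_le_div_right_of_nonneg (EReal.coe_nonneg.2 hu0) hu).trans_eq ?_
        rw [EReal.add_div_of_nonneg_right (EReal.coe_nonneg.2 hu0), add_comm, ← EReal.coe_div]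
        rfl
    _ ≤ c + lowerSlope B := by
        rw [← hlim]
        exact EReal.liminf_add_le (.inl (by simp [hlim])) (.inl (by simp [hlim]))

lemma le_lowerSlope_of_le_add_const {c K : ℝ}
    (h : ∀ᶠ u in atTop, ((c * u : ℝ) : EReal) ≤ A u + K) : c ≤ lowerSlope A :=
  (le_lowerSlope (.of_forall fun _ => le_rfl)).trans <|
    (lowerSlope_le_add (tendsto_const_nhds.div_atTop tendsto_id) h).trans_eq (zero_add _)

lemma lowerSlope_add_le : lowerSlope A + lowerSlope B ≤ lowerSlope fun u => A u + B u := by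
  refine EReal.le_liminf_add.trans_eq (liminf_congr ?_)
  filter_upwards [eventually_ge_atTop 0] with u hu
  exact (EReal.add_div_of_nonneg_right (EReal.coe_nonneg.2 hu)).symm

lemma lowerSlope_comp_mul {θ : ℝ} (hθ : 0 < θ) :
    lowerSlope (fun u => A (θ * u)) = θ * lowerSlope A := by
  have hdiv (u : ℝ) : A (θ * u) / u = θ * (A (θ * u) / ((θ * u : ℝ) : EReal)) := by
    rw [EReal.coe_mul, EReal.mul_div, mul_comm (θ : EReal) u, ← EReal.div_div, ← EReal.mul_div,
      ← EReal.mul_div, EReal.mul_div_cancel (EReal.coe_ne_bot _) (EReal.coe_ne_top _)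
        (EReal.coe_ne_zero.2 hθ.ne')]
  calc lowerSlope (fun u => A (θ * u))
      = θ * liminf ((fun u => A u / u) ∘ (θ * ·)) atTop := by
        rw [← EReal.liminf_const_mul_of_nonneg_of_ne_top (EReal.coe_nonneg.2 hθ.le)
          (EReal.coe_ne_top _)]
        exact liminf_congr (.of_forall hdiv)
    _ = θ * lowerSlope A := by
        rw [liminf_comp, show map (θ * ·) atTop = atTop from (OrderIso.mulLeft₀ θ hθ).map_atTop]
        rfl

lemma lowerSlope_le_of_seq {x ε : ℕ → ℝ} {p : ℝ} (hx : Tendsto x atTop atTop)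
    (hε : Tendsto ε atTop (𝓝 0)) (h : ∀ᶠ n in atTop, A (x n) ≤ ((x n * (p + ε n) : ℝ) : EReal)) :
    lowerSlope A ≤ p := by
  have hlim : Tendsto (fun n => ((p + ε n : ℝ) : EReal)) atTop (𝓝 p) :=
    (continuous_coe_real_ereal.tendsto p).comp (by simpa only [add_zero] using hε.const_add p)
  calc lowerSlope A ≤ liminf ((fun u => A u / u) ∘ x) atTop := hx.liminf_le_liminf_comp
    _ ≤ liminf (fun n => ((p + ε n : ℝ) : EReal)) atTop := by
        refine liminf_le_liminf ?_
        filter_upwards [h, hx.eventually_gt_atTop 0] with n hn hn0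
        rwa [Function.comp_apply, EReal.div_le_iff_le_mul (EReal.coe_pos.2 hn0)
          (EReal.coe_ne_top _), ← EReal.coe_mul]
    _ = p := hlim.liminf_eq

end LowerSlope

section Spectrum

variable {X : Type*} [MetricSpace X]

lemma ofReal_le_iInf_coverNum_iff (θ s u K : ℝ) :
    ENNReal.ofReal
        (2 ^ (-K) * ((((2 : ℝ≥0) ^ (-u) : ℝ≥0) : ℝ) ^ θ / ((2 : ℝ≥0) ^ (-u) : ℝ≥0)) ^ s) ≤
      ((⨅ x : X, coverNum ((2 : ℝ≥0) ^ (-u))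
        (Metric.closedBall x ((((2 : ℝ≥0) ^ (-u) : ℝ≥0) : ℝ) ^ θ)) : ℕ∞) : ℝ≥0∞) ↔
    (((1 - θ) * s * u - K : ℝ) : EReal) ≤ lowerCovering X u (θ * u) := by
  have hradius : (((2 : ℝ≥0) ^ (-u) : ℝ≥0) : ℝ) ^ θ = 2 ^ (-(θ * u)) := by
    rw [NNReal.coe_rpow, NNReal.coe_ofNat, ← Real.rpow_mul zero_le_two]
    ring_nf
  have hratio : 2 ^ (-K) * ((2 : ℝ) ^ (-(θ * u)) / ((2 : ℝ≥0) ^ (-u) : ℝ≥0)) ^ s =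
      2 ^ ((1 - θ) * s * u - K) := by
    rw [NNReal.coe_rpow, NNReal.coe_ofNat, ← Real.rpow_sub two_pos, ← Real.rpow_mul zero_le_two,
      ← Real.rpow_add two_pos]
    ring_nf
  rw [hradius, hratio, lowerCovering, coe_le_logTwo_iff]

/-- The substitution `r = 2 ^ (-u)`, `C = 2 ^ (-K)`. -/
lemma exists_forall_le_iInf_coverNum_iff (θ s : ℝ) :
    (∃ C : ℝ, 0 < C ∧ ∀ r : ℝ≥0, 0 < r → r < 1 →
      ENNReal.ofReal (C * ((r : ℝ) ^ θ / (r : ℝ)) ^ s) ≤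
        ((⨅ x : X, coverNum r (Metric.closedBall x ((r : ℝ) ^ θ)) : ℕ∞) : ℝ≥0∞)) ↔
    ∃ K : ℝ, ∀ u > 0, (((1 - θ) * s * u - K : ℝ) : EReal) ≤ lowerCovering X u (θ * u) := by
  constructor
  · rintro ⟨C, hC, h⟩
    refine ⟨-Real.logb 2 C, fun u hu => (ofReal_le_iInf_coverNum_iff θ s u _).1 ?_⟩
    rw [neg_neg, Real.rpow_logb two_pos (by norm_num) hC]
    exact h _ (NNReal.rpow_pos two_pos)
      (NNReal.rpow_lt_one_of_one_lt_of_neg one_lt_two (neg_lt_zero.2 hu))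
  · rintro ⟨K, h⟩
    refine ⟨2 ^ (-K), by positivity, fun r hr0 hr1 => ?_⟩
    obtain ⟨u, hu, rfl⟩ : ∃ u : ℝ, 0 < u ∧ (2 : ℝ≥0) ^ (-u) = r := by
      have hlog : Real.logb 2 r < 0 :=
        Real.logb_neg one_lt_two (NNReal.coe_pos.2 hr0) (by exact_mod_cast hr1)
      refine ⟨-Real.logb 2 r, neg_pos.2 hlog, ?_⟩
      rw [← NNReal.coe_inj, NNReal.coe_rpow, neg_neg, NNReal.coe_ofNat,
        Real.rpow_logb two_pos (by norm_num) (NNReal.coe_pos.2 hr0)]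
    exact (ofReal_le_iInf_coverNum_iff θ s u K).2 (h u hu)

lemma coe_ofReal_mul_coe_nnreal {a : ℝ} (ha : 0 ≤ a) (s : ℝ≥0) :
    ((ENNReal.ofReal a * s : ℝ≥0∞) : EReal) = ((a * s : ℝ) : EReal) := by
  rw [EReal.coe_ennreal_mul, EReal.coe_ennreal_ofReal, max_eq_left ha, EReal.coe_mul]
  rfl

lemma coe_ofReal_mul_lowerSpectrum {θ : ℝ} (hθ : θ < 1) :
    ((ENNReal.ofReal (1 - θ) * lowerSpectrum θ X : ℝ≥0∞) : EReal) =
      lowerSlope fun u => lowerCovering X u (θ * u) := by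
  have hθ' : 0 < 1 - θ := sub_pos.2 hθ
  simp only [lowerSpectrum, exists_forall_le_iInf_coverNum_iff, mem_ofPred_eq]
  apply le_antisymm
  · have hslope : 0 ≤ lowerSlope fun u => lowerCovering X u (θ * u) :=
      le_lowerSlope (.of_forall fun u => by simpa using lowerCovering_nonneg u (θ * u))
    rw [← EReal.coe_toENNReal hslope, EReal.coe_ennreal_le_coe_ennreal_iff, ENNReal.mul_iSup]
    refine iSup_le fun s => ?_
    rw [ENNReal.mul_iSup]
    refine iSup_le fun ⟨K, hK⟩ => ?_
    rw [← EReal.coe_ennreal_le_coe_ennreal_iff, EReal.coe_toENNReal hslope,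
      coe_ofReal_mul_coe_nnreal hθ'.le]
    refine le_lowerSlope_of_le_add_const (K := K) ?_
    filter_upwards [eventually_gt_atTop 0] with u hu
    have hKu := hK u hu
    rwa [EReal.coe_sub, EReal.sub_le_iff_le_add (.inl (EReal.coe_ne_bot K))
      (.inl (EReal.coe_ne_top K))] at hKu
  · refine EReal.ge_of_forall_gt_iff_ge.1 fun c hc => ?_
    rcases lt_or_ge c 0 with hc0 | hc0
    · exact (EReal.coe_le_coe_iff.2 hc0.le).trans (EReal.coe_ennreal_nonneg _)
    obtain ⟨u₀, hu₀⟩ := eventually_atTop.1 (eventually_le_of_lt_lowerSlope hc)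
    let s : ℝ≥0 := ⟨c / (1 - θ), div_nonneg hc0 hθ'.le⟩
    have hs : (1 - θ) * s = c := mul_div_cancel₀ c hθ'.ne'
    rw [← hs, ← coe_ofReal_mul_coe_nnreal hθ'.le, EReal.coe_ennreal_le_coe_ennreal_iff]
    gcongr
    refine le_iSup₂ (f := fun (s : ℝ≥0) _ => (s : ℝ≥0∞)) s ⟨c * |u₀|, fun u _ => ?_⟩
    rw [hs]
    rcases le_total u₀ u with huu | huu
    · exact (EReal.coe_le_coe_iff.2 (sub_le_self _ (by positivity))).trans (hu₀ u huu)
    · refine le_trans ?_ (lowerCovering_nonneg _ _)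
      exact EReal.coe_nonpos.2 (sub_nonpos.2 (by gcongr; exact huu.trans (le_abs_self u₀)))

end Spectrum

/-! ### Spectra of uniform spaces -/

section Necessity

variable {X : Type*} [MetricSpace X] {η : ℝ → ℝ} {φ : ℝ → ℝ}

lemma IsUniformWith.tendsto_div (h : IsUniformWith X η) :
    Tendsto (fun u => η u / u) atTop (𝓝 0) := by
  simpa only [div_eq_inv_mul] using h.1

lemma tendsto_comp_mul_div {θ : ℝ} (hθ : 0 < θ)
    (h : Tendsto (fun u => η u / u) atTop (𝓝 0)) :
    Tendsto (fun u => η (θ * u) / u) atTop (𝓝 0) := by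
  have hlim := (h.comp (tendsto_id.const_mul_atTop hθ)).const_mul θ
  rw [mul_zero] at hlim
  refine hlim.congr fun u => ?_
  simp only [Function.comp_apply, id]
  rw [← mul_div_assoc, mul_div_mul_left _ _ hθ.ne']

lemma lipschitzOnWith_of_superadd {d : ℝ≥0} (hnonneg : ∀ θ ∈ Ioc (0 : ℝ) 1, 0 ≤ φ θ)
    (hsuper : ∀ l ∈ Ioc (0 : ℝ) 1, ∀ θ ∈ Ioc (0 : ℝ) 1, φ θ ≤ φ (l * θ) - θ * φ l)
    (hle : ∀ s ∈ Ioc (0 : ℝ) 1, ∀ t ∈ Ioc (0 : ℝ) 1, s ≤ t → φ s ≤ φ t + d * (t - s)) :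
    LipschitzOnWith d φ (Ioc 0 1) := by
  have hanti : ∀ s ∈ Ioc (0 : ℝ) 1, ∀ t ∈ Ioc (0 : ℝ) 1, s ≤ t → φ t ≤ φ s := by
    intro s hs t ht hst
    have hmem : s / t ∈ Ioc (0 : ℝ) 1 := ⟨div_pos hs.1 ht.1, div_le_one_of_le₀ hst ht.1.le⟩
    have h := hsuper _ hmem t ht
    rw [div_mul_cancel₀ _ ht.1.ne'] at h
    linarith [mul_nonneg ht.1.le (hnonneg _ hmem)]
  refine LipschitzOnWith.of_dist_le_mul fun s hs t ht => ?_
  wlog hst : s ≤ t generalizing s t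
  · rw [dist_comm, dist_comm s]
    exact this t ht s hs (le_of_not_ge hst)
  rw [Real.dist_eq, dist_comm, Real.dist_eq, abs_of_nonneg (sub_nonneg.2 hst),
    abs_of_nonneg (sub_nonneg.2 (hanti s hs t ht hst))]
  linarith [hle s hs t ht hst]

lemma HasScaledLowerSpectrum.lowerSlope_eq (h : HasScaledLowerSpectrum X φ) {θ : ℝ}
    (hθ : θ ∈ Ioo 0 1) (hφ : 0 ≤ φ θ) : lowerSlope (fun u => lowerCovering X u (θ * u)) = φ θ := by
  rw [← coe_ofReal_mul_lowerSpectrum hθ.2, h.1 θ hθ, EReal.coe_ennreal_ofReal, max_eq_left hφ]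

lemma HasScaledLowerSpectrum.map_one_eq_zero {d : ℝ} (h : HasScaledLowerSpectrum X φ)
    (hle : ∀ θ ∈ Ioo (0 : ℝ) 1, φ θ ≤ d * (1 - θ)) (hφ : 0 ≤ φ 1) : φ 1 = 0 := by
  have hlim : Tendsto (fun θ : ℝ => ENNReal.ofReal (d * (1 - θ))) (𝓝[<] 1) (𝓝 0) := by
    have hcont : Continuous fun θ : ℝ => ENNReal.ofReal (d * (1 - θ)) :=
      ENNReal.continuous_ofReal.comp (by fun_prop)
    simpa using (hcont.tendsto 1).mono_left nhdsWithin_le_nhds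
  have hzero : ENNReal.ofReal (φ 1) ≤ 0 := by
    refine le_of_tendsto_of_tendsto h.2 hlim ?_
    filter_upwards [Ioo_mem_nhdsLT zero_lt_one] with θ hθ
    rw [h.1 θ hθ]
    exact ENNReal.ofReal_le_ofReal (hle θ hθ)
  exact (ENNReal.ofReal_eq_zero.1 (nonpos_iff_eq_zero.1 hzero)).antisymm hφ

variable [Nonempty X]

lemma IsUniformWith.lowerCovering_add_le (h : IsUniformWith X η) {M u v w : ℝ}
    (hM : upperBranching X (w + 1) w ≤ M) (hwv : w + 1 ≤ v) (hvu : v + 1 ≤ u) :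
    lowerCovering X u v + lowerCovering X v w ≤
      lowerCovering X u w + ((M + η v + η u : ℝ) : EReal) := by
  have hvw : lowerCovering X v w ≤ lowerBranching X v (w + 1) + ((M + η v : ℝ) : EReal) :=
    calc lowerCovering X v w ≤ upperBranching X v w := lowerCovering_le_upperBranching v w
      _ ≤ upperBranching X (w + 1) w + upperBranching X v (w + 1) :=
          upperBranching_le_add v (w + 1) w
      _ ≤ M + (lowerBranching X v (w + 1) + η v) := add_le_add hM (h.2 v (w + 1) hwv)
      _ = _ := by rw [EReal.coe_add]; ac_rfl
  have huv : lowerCovering X u v ≤ lowerBranching X u v + η u :=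
    (lowerCovering_le_upperBranching u v).trans (h.2 u v (by linarith))
  calc lowerCovering X u v + lowerCovering X v w
      ≤ lowerBranching X u v + η u + (lowerBranching X v (w + 1) + ((M + η v : ℝ) : EReal)) :=
        add_le_add huv hvw
    _ = lowerBranching X v (w + 1) + lowerBranching X u v + ((M + η v + η u : ℝ) : EReal) := by
        rw [EReal.coe_add (M + η v)]; ac_rfl
    _ ≤ lowerCovering X u w + ((M + η v + η u : ℝ) : EReal) :=
        add_le_add_left
          ((add_le_lowerBranching hwv hvu).trans (lowerBranching_le_lowerCovering u w)) _

lemma IsUniformWith.lowerSlope_superadd (h : IsUniformWith X η) {M : ℝ}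
    (hM : ∀ w, upperBranching X (w + 1) w ≤ M) {l θ : ℝ} (hl : l < 1) (hθ : θ ∈ Ioo 0 1) :
    lowerSlope (fun u => lowerCovering X u (θ * u)) +
        θ * lowerSlope (fun u => lowerCovering X u (l * u)) ≤
      lowerSlope fun u => lowerCovering X u (l * θ * u) := by
  have hE : Tendsto (fun u => (M + η (θ * u) + η u) / u) atTop (𝓝 0) := by
    simp only [add_div]
    simpa using ((tendsto_const_nhds.div_atTop tendsto_id).add
      (tendsto_comp_mul_div hθ.1 h.tendsto_div)).add h.tendsto_div
  rw [← lowerSlope_comp_mul (A := fun u => lowerCovering X u (l * u)) hθ.1]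
  refine lowerSlope_add_le.trans ((lowerSlope_le_add hE ?_).trans_eq (zero_add _))
  have hθl : 0 < θ * (1 - l) := mul_pos hθ.1 (sub_pos.2 hl)
  filter_upwards [(tendsto_id.const_mul_atTop (sub_pos.2 hθ.2)).eventually_ge_atTop 1,
    (tendsto_id.const_mul_atTop hθl).eventually_ge_atTop 1] with u hu hu'
  simp only [id] at hu hu'
  rw [mul_assoc l θ u]
  exact h.lowerCovering_add_le (hM _) (by linarith) (by linarith)

variable {d : ℝ≥0} {K : ℝ}

lemma IsUniformWith.lowerSlope_le_add_mul (h : IsUniformWith X η)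
    (hK : ∀ u v, v ≤ u → upperBranching X u v ≤ ((d * (u - v) + K : ℝ) : EReal))
    {s t : ℝ} (hst : s ≤ t) (ht : t ≤ 1) :
    lowerSlope (fun u => lowerCovering X u (s * u)) ≤
      ((d * (t - s) : ℝ) : EReal) + lowerSlope fun u => lowerCovering X u (t * u) := by
  have hE : Tendsto (fun u => (d * (t * u - s * u) + K + η u) / u) atTop (𝓝 (d * (t - s))) := by
    have hlim : Tendsto (fun u => d * (t - s) + K / u + η u / u) atTop (𝓝 (d * (t - s) + 0 + 0)) :=
      ((tendsto_const_nhds.div_atTop tendsto_id).const_add _).add h.tendsto_div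
    rw [add_zero, add_zero] at hlim
    refine hlim.congr' ?_
    filter_upwards [eventually_ne_atTop 0] with u hu
    field_simp
  refine lowerSlope_le_add hE ?_
  filter_upwards [eventually_ge_atTop 0] with u hu
  have hst' : s * u ≤ t * u := mul_le_mul_of_nonneg_right hst hu
  have htu : t * u ≤ u := mul_le_of_le_one_left hu ht
  calc lowerCovering X u (s * u)
      ≤ upperBranching X u (s * u) := lowerCovering_le_upperBranching _ _
    _ ≤ upperBranching X (t * u) (s * u) + upperBranching X u (t * u) := upperBranching_le_add _ _ _
    _ ≤ ((d * (t * u - s * u) + K : ℝ) : EReal) + (lowerCovering X u (t * u) + η u) :=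
        add_le_add (hK _ _ hst') ((h.2 _ _ htu).trans
          (add_le_add_left (lowerBranching_le_lowerCovering _ _) _))
    _ = _ := by rw [EReal.coe_add _ (η u)]; ac_rfl

lemma lowerSlope_lowerCovering_le
    (hK : ∀ u v, v ≤ u → upperBranching X u v ≤ ((d * (u - v) + K : ℝ) : EReal))
    {θ : ℝ} (hθ : θ ≤ 1) :
    lowerSlope (fun u => lowerCovering X u (θ * u)) ≤ ((d * (1 - θ) : ℝ) : EReal) := by
  refine lowerSlope_le_of_seq tendsto_natCast_atTop_atTop
    (tendsto_const_div_atTop_nhds_zero_nat K) ?_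
  filter_upwards [eventually_ne_atTop 0] with n hn
  refine (lowerCovering_le_upperBranching _ _).trans
    ((hK _ _ (mul_le_of_le_one_left n.cast_nonneg hθ)).trans_eq ?_)
  have hn' : (n : ℝ) ≠ 0 := Nat.cast_ne_zero.2 hn
  congr 1
  field_simp

theorem IsUniformWith.isSpectrumProfile (h : IsUniformWith X η) (hφ : HasScaledLowerSpectrum X φ)
    (hK : ∀ u v, v ≤ u → upperBranching X u v ≤ ((d * (u - v) + K : ℝ) : EReal))
    (hnonneg : ∀ θ ∈ Ioc (0 : ℝ) 1, 0 ≤ φ θ) : IsSpectrumProfile d φ := by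
  have hslope : ∀ θ ∈ Ioo (0 : ℝ) 1, lowerSlope (fun u => lowerCovering X u (θ * u)) = φ θ :=
    fun θ hθ => hφ.lowerSlope_eq hθ (hnonneg θ (Ioo_subset_Ioc_self hθ))
  have hle_one : ∀ θ ∈ Ioo (0 : ℝ) 1, φ θ ≤ d * (1 - θ) := fun θ hθ => by
    have hle := lowerSlope_lowerCovering_le hK hθ.2.le
    rwa [hslope θ hθ, EReal.coe_le_coe_iff] at hle
  have hone : φ 1 = 0 := hφ.map_one_eq_zero hle_one (hnonneg 1 (by simp))
  have hsuper : ∀ l ∈ Ioc (0 : ℝ) 1, ∀ θ ∈ Ioc (0 : ℝ) 1, φ θ ≤ φ (l * θ) - θ * φ l := by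
    intro l hl θ hθ
    rcases hl.2.eq_or_lt with rfl | hl1
    · simp [hone]
    rcases hθ.2.eq_or_lt with rfl | hθ1
    · simp [hone]
    have hle := h.lowerSlope_superadd (M := d + K) (fun w => by simpa using hK (w + 1) w (by simp))
      hl1 ⟨hθ.1, hθ1⟩
    rw [hslope θ ⟨hθ.1, hθ1⟩, hslope l ⟨hl.1, hl1⟩,
      hslope (l * θ) ⟨mul_pos hl.1 hθ.1, mul_lt_one_of_nonneg_of_lt_one_left hl.1.le hl1 hθ.2⟩,
      ← EReal.coe_mul, ← EReal.coe_add, EReal.coe_le_coe_iff] at hle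
    linarith
  refine ⟨hnonneg, lipschitzOnWith_of_superadd hnonneg hsuper fun s hs t ht hst => ?_, hsuper⟩
  rcases ht.2.eq_or_lt with rfl | ht1
  · rcases hst.eq_or_lt with rfl | hs1
    · simp
    · simpa [hone] using hle_one s ⟨hs.1, hs1⟩
  · have hle := h.lowerSlope_le_add_mul hK hst ht.2
    rw [hslope s ⟨hs.1, hst.trans_lt ht1⟩, hslope t ⟨ht.1, ht1⟩, ← EReal.coe_add,
      EReal.coe_le_coe_iff] at hle
    linarith

end Necessity

/-! ### Covering numbers in Euclidean space -/

section Euclidean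

variable {d : ℕ}

lemma euclidean_dist_le_two_pow_mul {x y : EuclideanSpace ℝ (Fin d)} {δ : ℝ} (hδ : 0 ≤ δ)
    (h : ∀ i, |x i - y i| ≤ δ) : dist x y ≤ 2 ^ d * δ := by
  rw [EuclideanSpace.dist_eq]
  refine Real.sqrt_le_iff.2 ⟨by positivity, ?_⟩
  have hd : (d : ℝ) ≤ 2 ^ d := by exact_mod_cast Nat.lt_two_pow_self.le
  calc ∑ i, dist (x i) (y i) ^ 2 ≤ ∑ _i : Fin d, δ ^ 2 := by
        gcongr with i
        exact h i
    _ = d * δ ^ 2 := by simp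
    _ ≤ (2 ^ d) ^ 2 * δ ^ 2 := by
        gcongr
        exact hd.trans (le_self_pow₀ (one_le_pow₀ one_le_two) two_ne_zero)
    _ = (2 ^ d * δ) ^ 2 := by ring

lemma euclidean_abs_sub_le_dist (x y : EuclideanSpace ℝ (Fin d)) (i : Fin d) :
    |x i - y i| ≤ dist x y := by
  rw [dist_eq_norm]
  exact PiLp.norm_apply_le (x - y) i

lemma abs_sub_le_of_floor_mul_eq {t a b : ℝ} (ht : 0 < t) (h : ⌊t * a⌋ = ⌊t * b⌋) :
    |a - b| ≤ t⁻¹ := by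
  have hlt := Int.abs_sub_lt_one_of_floor_eq_floor h
  rw [← mul_sub, abs_mul, abs_of_pos ht] at hlt
  rw [inv_eq_one_div, le_div_iff₀' ht]
  exact hlt.le

lemma card_Icc_floor_le {a b : ℝ} (hab : a ≤ b) :
    ((Finset.Icc ⌊a⌋ ⌊b⌋).card : ℝ) ≤ b - a + 2 := by
  have hnonneg : 0 ≤ ⌊b⌋ + 1 - ⌊a⌋ := by linarith [Int.floor_le_floor hab]
  have hcard : ((Finset.Icc ⌊a⌋ ⌊b⌋).card : ℝ) = ⌊b⌋ + 1 - ⌊a⌋ := by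
    rw [Int.card_Icc]
    exact_mod_cast Int.toNat_of_nonneg hnonneg
  linarith [Int.floor_le b, Int.lt_floor_add_one a]

lemma card_Icc_floor_two_rpow_le {u v : ℝ} (huv : v ≤ u + d) (a : ℝ) :
    ((Finset.Icc ⌊2 ^ (u + d) * (a - 2 ^ (-v))⌋ ⌊2 ^ (u + d) * (a + 2 ^ (-v))⌋).card : ℝ) ≤
      2 ^ (u - v + (d + 2)) := by
  have hscale : (2 : ℝ) ^ (u + d) * 2 ^ (-v) = 2 ^ (u - v + d) := by
    rw [← Real.rpow_add two_pos]
    ring_nf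
  have hone : (1 : ℝ) ≤ 2 ^ (u - v + d) := Real.one_le_rpow one_le_two (by linarith)
  calc _ ≤ 2 ^ (u + d) * (a + 2 ^ (-v)) - 2 ^ (u + d) * (a - 2 ^ (-v)) + 2 :=
        card_Icc_floor_le (by gcongr; linarith [Real.rpow_pos_of_pos two_pos (-v)])
    _ = 2 * 2 ^ (u - v + d) + 2 := by rw [← hscale]; ring
    _ ≤ 4 * 2 ^ (u - v + d) := by linarith
    _ = 2 ^ (u - v + (d + 2)) := by
        rw [← add_assoc, Real.rpow_add two_pos (u - v + d)]
        norm_num [mul_comm]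

/-- The ball meets at most `2 ^ (d (u - v + d + 2))` cells of the cubic grid of mesh
`2 ^ (-(u + d))`, and each cell has diameter at most `2 ^ (-u)`. -/
lemma upperBranching_le_of_euclidean (F : Set (EuclideanSpace ℝ (Fin d))) {u v : ℝ} (huv : v ≤ u) :
    upperBranching F u v ≤ ((d * (u - v) + d * (d + 2) : ℝ) : EReal) := by
  let cells (x : F) : Finset (Fin d → ℤ) := Fintype.piFinset fun i =>
    Finset.Icc ⌊2 ^ (u + d) * (x.1 i - 2 ^ (-v))⌋ ⌊2 ^ (u + d) * (x.1 i + 2 ^ (-v))⌋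
  have hcard (x : F) : ((cells x).card : ℝ) ≤ 2 ^ (d * (u - v) + d * (d + 2) : ℝ) := by
    rw [Fintype.card_piFinset, Nat.cast_prod, ← mul_add, mul_comm,
      Real.rpow_mul_natCast zero_le_two]
    refine (Finset.prod_le_prod (fun _ _ => Nat.cast_nonneg _) fun i _ =>
      card_Icc_floor_two_rpow_le (by linarith [(d.cast_nonneg : (0 : ℝ) ≤ d)]) (x.1 i)).trans_eq ?_
    rw [Finset.prod_const, Finset.card_univ, Fintype.card_fin]
  have hmesh : 2 ^ d * ((2 : ℝ) ^ (u + d))⁻¹ = ((2 : ℝ≥0) ^ (-u) : ℝ≥0) := by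
    rw [NNReal.coe_rpow, NNReal.coe_ofNat, Real.rpow_add_natCast two_ne_zero,
      Real.rpow_neg zero_le_two]
    field_simp
  refine logTwo_le_coe_iff.2 ?_
  rw [ENat.toENNReal_iSup]
  refine iSup_le fun x => ?_
  refine logTwo_le_coe_iff.1 ((logTwo_mono (coverNum_le_card_of_code
    (fun y : F => fun i => ⌊2 ^ (u + d) * y.1 i⌋) (cells x) (fun y hy => ?_)
      fun y _ z _ hyz => ?_)).trans (logTwo_natCast_le_coe (hcard x)))
  · refine Fintype.mem_piFinset.2 fun i => Finset.mem_Icc.2 ?_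
    have hyx := abs_le.1 ((euclidean_abs_sub_le_dist y.1 x.1 i).trans (Metric.mem_closedBall.1 hy))
    constructor <;> gcongr <;> linarith
  · exact (euclidean_dist_le_two_pow_mul (by positivity) fun i =>
      abs_sub_le_of_floor_mul_eq (by positivity) (congrFun hyz i)).trans_eq hmesh

end Euclidean

/-! ### Sets with prescribed branching functions -/

section Digits

variable {b : ℕ}

/-- The integer whose base-`b` digits are the first `k` terms of `x`. -/
def digitPrefix (x : ℕ → Fin b) : ℕ → ℕ
  | 0 => 0
  | k + 1 => b * digitPrefix x k + x k

lemma eq_of_digitPrefix_eq {x y : ℕ → Fin b} {k : ℕ} (h : digitPrefix x k = digitPrefix y k) :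
    ∀ j < k, x j = y j := by
  induction k with
  | zero => simp
  | succ k ih =>
    have hlast : (x k : ℕ) = y k := by
      simpa [digitPrefix, Nat.mod_eq_of_lt] using congrArg (· % b) h
    have hinit : digitPrefix x k = digitPrefix y k := by
      simpa [digitPrefix, hlast, (x k).pos.ne'] using h
    intro j hj
    rcases Nat.lt_succ_iff_lt_or_eq.1 hj with hj | rfl
    · exact ih hinit j hj
    · exact Fin.ext hlast

lemma pow_mul_ofDigits_eq (x : ℕ → Fin b) (k : ℕ) :
    b ^ k * Real.ofDigits x = digitPrefix x k + Real.ofDigits fun i => x (i + k) := by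
  have hb : (b : ℝ) ≠ 0 := Nat.cast_ne_zero.2 (x 0).pos.ne'
  have hsum : b ^ k * ∑ i ∈ Finset.range k, Real.ofDigitsTerm x i = digitPrefix x k := by
    induction k with
    | zero => simp [digitPrefix]
    | succ k ih =>
      rw [Finset.sum_range_succ, mul_add, pow_succ', mul_assoc, ih, ← pow_succ',
        Real.ofDigitsTerm, digitPrefix]
      push_cast
      field_simp
  rw [Real.ofDigits_eq_sum_add_ofDigits x k, mul_add, hsum,
    mul_inv_cancel_left₀ (pow_ne_zero k hb)]

lemma abs_digitPrefix_sub_le (x y : ℕ → Fin b) (k : ℕ) :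
    |(digitPrefix x k : ℝ) - digitPrefix y k| ≤
      b ^ k * |Real.ofDigits x - Real.ofDigits y| + 1 := by
  have hsplit : (digitPrefix x k : ℝ) - digitPrefix y k =
      b ^ k * (Real.ofDigits x - Real.ofDigits y) +
        ((Real.ofDigits fun i => y (i + k)) - Real.ofDigits fun i => x (i + k)) := by
    linear_combination pow_mul_ofDigits_eq y k - pow_mul_ofDigits_eq x k
  rw [hsplit]
  refine (abs_add_le _ _).trans (add_le_add ?_ ?_)
  · rw [abs_mul, abs_of_nonneg (by positivity)]
  · exact abs_sub_le_of_nonneg_of_le (Real.ofDigits_nonneg _) (Real.ofDigits_le_one _)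
      (Real.ofDigits_nonneg _) (Real.ofDigits_le_one _)

lemma inv_pow_le_abs_ofDigits_sub [NeZero b] {x y : ℕ → Fin b} {j k : ℕ} (hjk : j < k)
    (hxy : x j ≠ y j) (hx : ∀ i, k ≤ i → x i = 0) (hy : ∀ i, k ≤ i → y i = 0) :
    ((b : ℝ) ^ k)⁻¹ ≤ |Real.ofDigits x - Real.ofDigits y| := by
  have hmul {z : ℕ → Fin b} (hz : ∀ i, k ≤ i → z i = 0) :
      (b : ℝ) ^ k * Real.ofDigits z = digitPrefix z k := by
    rw [pow_mul_ofDigits_eq, add_eq_left, Real.ofDigits, ← tsum_zero]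
    exact tsum_congr fun i => by simp [Real.ofDigitsTerm, hz (i + k) (Nat.le_add_left k i)]
  have hne : (digitPrefix x k : ℤ) - digitPrefix y k ≠ 0 := fun h =>
    hxy (eq_of_digitPrefix_eq (by lia) j hjk)
  have hb : (0 : ℝ) < b ^ k := pow_pos (Nat.cast_pos.2 (NeZero.pos b)) k
  rw [inv_le_iff_one_le_mul₀' hb]
  nth_rw 1 [← abs_of_pos hb]
  rw [← abs_mul, mul_sub, hmul hx, hmul hy]
  exact_mod_cast Int.one_le_abs hne

end Digits

section BinarySet

variable {d : ℕ} {W s t : Set (Fin d × ℕ)} {l k : ℕ}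

open scoped Classical in
/-- The binary digits of the `i`-th coordinate of the point encoded by `s`: those at the positions
in `s` are `1`, the others `0`. -/
def binaryDigits (s : Set (Fin d × ℕ)) (i : Fin d) (j : ℕ) : Fin 2 :=
  if (i, j) ∈ s then 1 else 0

/-- The point of the unit cube encoded by `s`. -/
def binaryPoint (s : Set (Fin d × ℕ)) : EuclideanSpace ℝ (Fin d) :=
  WithLp.toLp 2 fun i => Real.ofDigits (binaryDigits s i)

/-- The points of the unit cube whose binary digits are free at the positions in `W` and vanish at
all other positions. -/
def binarySet (W : Set (Fin d × ℕ)) : Set (EuclideanSpace ℝ (Fin d)) :=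
  binaryPoint '' 𝒫 W

open scoped Classical in
/-- The positions in `W` at the levels `l ≤ j < k`. -/
def window (W : Set (Fin d × ℕ)) (l k : ℕ) : Finset (Fin d × ℕ) :=
  {p ∈ Finset.univ ×ˢ Finset.Ico l k | p ∈ W}

lemma mem_window {p : Fin d × ℕ} : p ∈ window W l k ↔ (l ≤ p.2 ∧ p.2 < k) ∧ p ∈ W := by
  simp [window]

lemma binarySet_nonempty (W : Set (Fin d × ℕ)) : (binarySet W).Nonempty :=
  ⟨_, ∅, empty_subset W, rfl⟩

lemma binaryDigits_eq_iff {i : Fin d} {j : ℕ} :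
    binaryDigits s i j = binaryDigits t i j ↔ ((i, j) ∈ s ↔ (i, j) ∈ t) := by
  unfold binaryDigits
  split_ifs <;> simp_all

lemma dist_binaryPoint_le (h : ∀ i, ∀ j < k, (i, j) ∈ s ↔ (i, j) ∈ t) :
    dist (binaryPoint s) (binaryPoint t) ≤ 2 ^ d * ((2 : ℝ) ^ k)⁻¹ :=
  euclidean_dist_le_two_pow_mul (by positivity) fun i => by
    simpa [binaryPoint] using Real.abs_ofDigits_sub_ofDigits_le fun j hj =>
      binaryDigits_eq_iff.2 (h i j hj)

lemma inv_two_pow_le_dist_binaryPoint (hs : ∀ p ∈ s, p.2 < k) (ht : ∀ p ∈ t, p.2 < k)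
    (hst : s ≠ t) : ((2 : ℝ) ^ k)⁻¹ ≤ dist (binaryPoint s) (binaryPoint t) := by
  obtain ⟨⟨i, j⟩, hij⟩ : ∃ p, ¬(p ∈ s ↔ p ∈ t) := not_forall.1 fun h => hst (Set.ext h)
  have hjk : j < k := by
    by_contra hkj
    exact hij (iff_of_false (fun h => hkj (hs _ h)) fun h => hkj (ht _ h))
  have hzero {a : Set (Fin d × ℕ)} (ha : ∀ p ∈ a, p.2 < k) (n : ℕ) (hn : k ≤ n) :
      binaryDigits a i n = 0 :=
    if_neg fun h => hn.not_gt (ha _ h)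
  exact_mod_cast (inv_pow_le_abs_ofDigits_sub hjk (mt binaryDigits_eq_iff.1 hij) (hzero hs)
    (hzero ht)).trans (euclidean_abs_sub_le_dist (binaryPoint s) (binaryPoint t) i)

lemma abs_digitPrefix_binaryDigits_sub_le_two {R : ℝ} (hl : l = 0 ∨ 2 ^ l * R ≤ 1)
    (h : dist (binaryPoint s) (binaryPoint t) ≤ R) (i : Fin d) :
    |(digitPrefix (binaryDigits s i) l : ℤ) - digitPrefix (binaryDigits t i) l| ≤ 2 := by
  rcases hl with rfl | hl
  · simp [digitPrefix]
  have hcoord : |Real.ofDigits (binaryDigits s i) - Real.ofDigits (binaryDigits t i)| ≤ R :=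
    (euclidean_abs_sub_le_dist (binaryPoint s) (binaryPoint t) i).trans h
  have hreal : |(digitPrefix (binaryDigits s i) l : ℝ) - digitPrefix (binaryDigits t i) l| ≤ 2 :=
    calc _ ≤ (2 : ℕ) ^ l *
          |Real.ofDigits (binaryDigits s i) - Real.ofDigits (binaryDigits t i)| + 1 :=
          abs_digitPrefix_sub_le _ _ l
      _ ≤ 2 ^ l * R + 1 := by push_cast; gcongr
      _ ≤ 2 := by linarith
  exact_mod_cast hreal

/-- A point of the ball is determined up to `r` by the first `l` digits of its coordinates, for
which five values per coordinate remain, and by its digits in the window. -/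
lemma coverNum_binarySet_closedBall_le {r : ℝ≥0} {R : ℝ} (hl : l = 0 ∨ 2 ^ l * R ≤ 1)
    (hr : 2 ^ d * ((2 : ℝ) ^ k)⁻¹ ≤ r) (x : binarySet W) :
    coverNum r (Metric.closedBall x R) ≤ (5 ^ d * 2 ^ (window W l k).card : ℕ) := by
  classical
  choose s hsW hs using fun y : binarySet W => y.2
  have hdist (y z : binarySet W) : dist y z = dist (binaryPoint (s y)) (binaryPoint (s z)) := by
    rw [hs y, hs z, Subtype.dist_eq]
  let T (y : binarySet W) (i : Fin d) : ℤ := digitPrefix (binaryDigits (s y) i) l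
  let box : Finset (Fin d → ℤ) := Fintype.piFinset fun i => Finset.Icc (T x i - 2) (T x i + 2)
  have hbox : box.card = 5 ^ d := by
    have hIcc (i : Fin d) : (Finset.Icc (T x i - 2) (T x i + 2)).card = 5 := by
      rw [Int.card_Icc]
      lia
    simp [box, Fintype.card_piFinset, hIcc]
  rw [← hbox, ← Finset.card_powerset, ← Finset.card_product]
  refine coverNum_le_card_of_code (fun y => (T y, {p ∈ window W l k | p ∈ s y})) _
    (fun y hy => ?_) fun y _ z _ hyz => ?_
  · refine Finset.mem_product.2 ⟨Fintype.mem_piFinset.2 fun i => Finset.mem_Icc.2 ?_,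
      Finset.mem_powerset.2 (Finset.filter_subset _ _)⟩
    have hyx := abs_le.1 (abs_digitPrefix_binaryDigits_sub_le_two hl ((hdist y x).ge.trans hy) i)
    constructor <;> linarith
  · obtain ⟨hT, hwindow⟩ := Prod.mk.inj hyz
    refine (hdist y z).trans_le ((dist_binaryPoint_le fun i j hjk => ?_).trans hr)
    rcases lt_or_ge j l with hjl | hlj
    · have hprefix : (digitPrefix (binaryDigits (s y) i) l : ℤ) =
          digitPrefix (binaryDigits (s z) i) l := congrFun hT i
      exact binaryDigits_eq_iff.1 (eq_of_digitPrefix_eq (Int.ofNat_inj.1 hprefix) j hjl)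
    · have hmem := Finset.ext_iff.1 hwindow (i, j)
      simp only [Finset.mem_filter, mem_window, hlj, hjk, true_and] at hmem
      exact ⟨fun h => (hmem.1 ⟨hsW y h, h⟩).2, fun h => (hmem.2 ⟨hsW z h, h⟩).2⟩

/-- Keeping the first `l` digits of the coordinates of the centre, one may choose those in the
window freely. -/
lemma two_pow_le_packNum_binarySet_closedBall {r : ℝ≥0} {R : ℝ} (hlk : l ≤ k)
    (hl : 2 ^ d * ((2 : ℝ) ^ l)⁻¹ ≤ R) (hr : 4 * (r : ℝ) < ((2 : ℝ) ^ k)⁻¹) (x : binarySet W) :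
    ((2 ^ (window W l k).card : ℕ) : ℕ∞) ≤ packNum r (Metric.closedBall x R) := by
  classical
  obtain ⟨_, s, hsW, rfl⟩ := x
  let head : Set (Fin d × ℕ) := {p ∈ s | p.2 < l}
  let a (t : (window W l k).powerset) : Set (Fin d × ℕ) := head ∪ t.1
  have hwindow (t : (window W l k).powerset) : ∀ p ∈ t.1, (l ≤ p.2 ∧ p.2 < k) ∧ p ∈ W :=
    fun p hp => mem_window.1 (Finset.mem_powerset.1 t.2 hp)
  have haW (t : (window W l k).powerset) : a t ⊆ W :=
    union_subset (fun _ hp => hsW hp.1) fun p hp => (hwindow t p hp).2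
  have hak (t : (window W l k).powerset) : ∀ p ∈ a t, p.2 < k := fun p hp =>
    hp.elim (fun hp => hp.2.trans_le hlk) fun hp => (hwindow t p hp).1.2
  have hdiff (t : (window W l k).powerset) : a t \ head = t.1 :=
    union_sdiff_cancel_left fun p hp => (hwindow t p hp.2).1.1.not_gt hp.1.2
  have ha : Function.Injective a := fun t t' h => Subtype.ext <| Finset.coe_injective <| by
    rw [← hdiff t, ← hdiff t', h]
  let c (t : (window W l k).powerset) : binarySet W := ⟨binaryPoint (a t), a t, haW t, rfl⟩
  have hcard : (2 ^ (window W l k).card : ℕ) = Fintype.card (window W l k).powerset := by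
    rw [Fintype.card_coe, Finset.card_powerset]
  rw [hcard]
  refine card_le_packNum_of_family c (fun t => ?_) fun t t' htt' =>
    hr.trans_le (inv_two_pow_le_dist_binaryPoint (hak t) (hak t') (ha.ne htt'))
  refine Metric.mem_closedBall.2 (le_trans (dist_binaryPoint_le fun i j hj => ?_) hl)
  have hjt : (i, j) ∉ t.1 := fun h => (hwindow t _ h).1.1.not_gt hj
  simp [a, head, hj, hjt]

end BinarySet

section Realization

variable {d : ℕ}

lemma two_pow_mul_inv_two_pow_le {a : ℝ} {k : ℕ} (h : a + d ≤ k) :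
    (2 : ℝ) ^ d * (2 ^ k)⁻¹ ≤ 2 ^ (-a) := by
  rw [← Real.rpow_natCast, ← Real.rpow_natCast, ← Real.rpow_neg zero_le_two,
    ← Real.rpow_add two_pos]
  exact Real.rpow_le_rpow_of_exponent_le one_le_two (by linarith)

lemma upperBranching_binarySet_le (W : Set (Fin d × ℕ)) (u v : ℝ) :
    upperBranching (binarySet W) u v ≤
      (((window W ⌊v⌋₊ (⌈u⌉₊ + d)).card + 3 * d : ℝ) : EReal) := by
  have hl : ⌊v⌋₊ = 0 ∨ (2 : ℝ) ^ ⌊v⌋₊ * 2 ^ (-v) ≤ 1 := by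
    rcases le_total v 0 with hv | hv
    · exact .inl (Nat.floor_of_nonpos hv)
    · right
      rw [← Real.rpow_natCast, ← Real.rpow_add two_pos]
      exact Real.rpow_le_one_of_one_le_of_nonpos one_le_two (by linarith [Nat.floor_le hv])
  have hr : (2 : ℝ) ^ d * (2 ^ (⌈u⌉₊ + d))⁻¹ ≤ ((2 : ℝ≥0) ^ (-u) : ℝ≥0) := by
    push_cast
    exact two_pow_mul_inv_two_pow_le (by push_cast; linarith [Nat.le_ceil u])
  refine (logTwo_mono (iSup_le (coverNum_binarySet_closedBall_le hl hr))).trans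
    (logTwo_natCast_le_coe ?_)
  rw [Real.rpow_add two_pos, Real.rpow_natCast, Real.rpow_mul_natCast zero_le_two, mul_comm]
  push_cast
  gcongr
  norm_num

lemma card_window_le_lowerBranching_binarySet (W : Set (Fin d × ℕ)) (u v : ℝ) :
    (((window W (⌈v⌉₊ + d) (⌊u⌋₊ - 3)).card : ℝ) : EReal) ≤ lowerBranching (binarySet W) u v := by
  rcases le_or_gt (⌊u⌋₊ - 3) (⌈v⌉₊ + d) with hkl | hlk
  · simpa [window, Finset.Ico_eq_empty_of_le hkl] using lowerBranching_nonneg u v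
  have hl : (2 : ℝ) ^ d * (2 ^ (⌈v⌉₊ + d))⁻¹ ≤ 2 ^ (-v) :=
    two_pow_mul_inv_two_pow_le (by push_cast; linarith [Nat.le_ceil v])
  have hku : ((⌊u⌋₊ - 3 : ℕ) : ℝ) + 3 ≤ u := by
    have hadd : ⌊u⌋₊ - 3 + 3 = ⌊u⌋₊ := by lia
    exact_mod_cast hadd ▸ Nat.floor_le (Nat.pos_of_floor_pos (by lia)).le
  have hr : 4 * (((2 : ℝ≥0) ^ (-u) : ℝ≥0) : ℝ) < ((2 : ℝ) ^ (⌊u⌋₊ - 3))⁻¹ := by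
    have h4 : (4 : ℝ) = 2 ^ (2 : ℝ) := by norm_num
    push_cast
    rw [h4, ← Real.rpow_natCast, ← Real.rpow_neg zero_le_two, ← Real.rpow_add two_pos]
    exact Real.rpow_lt_rpow_of_exponent_lt one_lt_two (by linarith)
  exact (coe_le_logTwo_natCast (by simp)).trans
    (logTwo_mono (le_iInf (two_pow_le_packNum_binarySet_closedBall hlk.le hl hr)))

/-- The positions such that the first `M (j + 1) - M j` coordinates are free at each level `j`. -/
def freePositions (d : ℕ) (M : ℕ → ℕ) : Set (Fin d × ℕ) :=
  {p | (p.1 : ℕ) < M (p.2 + 1) - M p.2}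

lemma card_window_freePositions {M : ℕ → ℕ} (hM : Monotone M) (hd : ∀ k, M (k + 1) ≤ M k + d)
    (l k : ℕ) : (window (freePositions d M) l k).card = M k - M l := by
  classical
  have hlevel (j : ℕ) :
      (∑ i : Fin d, if (i, j) ∈ freePositions d M then 1 else 0) = M (j + 1) - M j := by
    rw [← Finset.card_filter]
    convert Fin.card_filter_val_lt.trans (min_eq_right (Nat.sub_le_iff_le_add'.2 (hd j)))
    rfl
  rw [window, Finset.card_filter, Finset.sum_product_right,
    Finset.sum_congr rfl fun j _ => hlevel j]
  rcases le_total l k with hlk | hkl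
  · induction k, hlk using Nat.le_induction with
    | base => simp
    | succ k hlk ih =>
      rw [Finset.sum_Ico_succ_top hlk, ih, add_comm,
        tsub_add_tsub_cancel (hM k.le_succ) (hM hlk)]
  · rw [Finset.Ico_eq_empty_of_le hkl, Finset.sum_empty, Nat.sub_eq_zero_of_le (hM hkl)]

lemma apply_natCeil_add_le {H : ℝ → ℝ} (hlip : ∀ v u, v ≤ u → H u ≤ H v + d * (u - v))
    (hconst : ∀ v ≤ 0, H v = H 0) (w : ℝ) : H (⌈w⌉₊ + d : ℕ) ≤ H w + d * (d + 1) := by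
  have hd : (0 : ℝ) ≤ d := d.cast_nonneg
  rcases le_total w 0 with hw | hw
  · have h := hlip 0 (d : ℕ) hd
    rw [Nat.ceil_eq_zero.2 hw, zero_add, hconst w hw]
    linarith
  · have hle : (⌈w⌉₊ : ℝ) ≤ w + 1 := (Nat.ceil_lt_add_one hw).le
    calc H (⌈w⌉₊ + d : ℕ) ≤ H w + d * ((⌈w⌉₊ + d : ℕ) - w) :=
          hlip _ _ (by push_cast; linarith [Nat.le_ceil w])
      _ ≤ H w + d * (d + 1) := by gcongr; push_cast; linarith

theorem exists_set_branching_near {H : ℝ → ℝ} (hmono : Monotone H)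
    (hlip : ∀ v u, v ≤ u → H u ≤ H v + d * (u - v)) (hconst : ∀ v ≤ 0, H v = H 0) :
    ∃ F : Set (EuclideanSpace ℝ (Fin d)), F.Nonempty ∧ ∃ c : ℝ, ∀ u v, v ≤ u →
      upperBranching F u v ≤ ((H u - H v + c : ℝ) : EReal) ∧
        ((H u - H v - c : ℝ) : EReal) ≤ lowerBranching F u v := by
  have hge {w e : ℝ} (n : ℕ) (he : 0 ≤ e) (hw : w ≤ n + e) : H w ≤ H n + d * e := by
    linarith [hmono hw, hlip n (n + e) (by linarith)]
  let M (j : ℕ) : ℕ := ⌊H j - H 0⌋₊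
  have hH0 (j : ℕ) : 0 ≤ H j - H 0 := sub_nonneg.2 (hmono j.cast_nonneg)
  have hM : Monotone M := fun i j hij =>
    Nat.floor_mono (sub_le_sub_right (hmono (Nat.cast_le.2 hij)) _)
  have hMd (k : ℕ) : M (k + 1) ≤ M k + d := by
    rw [← Nat.floor_add_natCast (hH0 k)]
    refine Nat.floor_mono ?_
    linarith [hge (w := (k + 1 : ℕ)) k zero_le_one (by push_cast; rfl)]
  have hMle (k : ℕ) : (M k : ℝ) ≤ H k - H 0 := Nat.floor_le (hH0 k)
  have hltM (k : ℕ) : H k - H 0 < M k + 1 := Nat.lt_floor_add_one _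
  refine ⟨_, binarySet_nonempty (freePositions d M), d * (d + 5) + 1, fun u v huv => ⟨?_, ?_⟩⟩
  · refine (upperBranching_binarySet_le _ u v).trans (EReal.coe_le_coe_iff.2 ?_)
    have hlk : ⌊v⌋₊ ≤ ⌈u⌉₊ + d :=
      ((Nat.floor_mono huv).trans (Nat.floor_le_ceil u)).trans le_self_add
    rw [card_window_freePositions hM hMd, Nat.cast_sub (hM hlk)]
    linarith [hMle (⌈u⌉₊ + d), hltM ⌊v⌋₊, apply_natCeil_add_le hlip hconst u,
      hge ⌊v⌋₊ zero_le_one (Nat.lt_floor_add_one v).le]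
  · refine le_trans (EReal.coe_le_coe_iff.2 ?_) (card_window_le_lowerBranching_binarySet _ u v)
    have hu : u ≤ (⌊u⌋₊ - 3 : ℕ) + 4 := by
      have h3 : (⌊u⌋₊ : ℝ) ≤ (⌊u⌋₊ - 3 : ℕ) + 3 := by exact_mod_cast le_tsub_add
      linarith [Nat.lt_floor_add_one u]
    have hsub : (M (⌊u⌋₊ - 3) : ℝ) - M (⌈v⌉₊ + d) ≤ (M (⌊u⌋₊ - 3) - M (⌈v⌉₊ + d) : ℕ) := by
      rw [sub_le_iff_le_add]
      exact_mod_cast le_tsub_add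
    rw [card_window_freePositions hM hMd]
    linarith [hMle (⌈v⌉₊ + d), hltM (⌊u⌋₊ - 3), apply_natCeil_add_le hlip hconst v,
      hge _ zero_le_four hu]

end Realization

namespace IsSpectrumProfile

variable {φ : ℝ → ℝ}

lemma lowerSlope_eq {d : ℝ≥0} (hφ : IsSpectrumProfile d φ) {A : ℝ → EReal} {c θ : ℝ}
    (hθ : θ ∈ Ioc (0 : ℝ) 1)
    (hle : ∀ᶠ u in atTop,
      A u ≤ ((branchingFun d φ u - branchingFun d φ (θ * u) + c : ℝ) : EReal))
    (hge : ∀ᶠ u in atTop,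
      ((branchingFun d φ u - branchingFun d φ (θ * u) - c : ℝ) : EReal) ≤ A u) :
    lowerSlope A = φ θ := by
  apply le_antisymm
  · have hfac : Tendsto (fun n : ℕ => ((n + 1).factorial : ℝ)) atTop atTop :=
      tendsto_natCast_atTop_atTop.comp (factorial_tendsto_atTop.comp (tendsto_add_atTop_nat 1))
    have hε : Tendsto (fun n : ℕ => d / ((n : ℝ) + 1) + c / (n + 1).factorial) atTop (𝓝 0) := by
      simpa using (tendsto_const_nhds.div_atTop
        (tendsto_natCast_atTop_atTop.atTop_add tendsto_const_nhds)).add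
          (tendsto_const_nhds.div_atTop hfac)
    refine lowerSlope_le_of_seq hfac hε ?_
    filter_upwards [hfac.eventually hle, (tendsto_natCast_atTop_atTop.atTop_add
      tendsto_const_nhds).eventually_ge_atTop θ⁻¹] with n hn hnθ
    refine hn.trans (EReal.coe_le_coe_iff.2 ?_)
    have hn1 : 1 ≤ θ * (n + 1) := (inv_le_iff_one_le_mul₀' hθ.1).1 hnθ
    have herror : (n + 1).factorial * (d / ((n : ℝ) + 1) + c / (n + 1).factorial) =
        d * n.factorial + c := by
      rw [Nat.factorial_succ]
      push_cast
      field_simp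
    rw [mul_add, herror]
    linarith [hφ.branchingFun_factorial_sub_le n hθ.2 hn1]
  · refine le_lowerSlope_of_le_add_const (K := c) ?_
    filter_upwards [hge, eventually_gt_atTop 0] with u hu hu0
    have hmain := hφ.mul_le_branchingFun_sub (mul_pos hθ.1 hu0)
      (mul_le_of_le_one_left hu0.le hθ.2)
    rw [mul_div_cancel_right₀ θ hu0.ne'] at hmain
    calc ((φ θ * u : ℝ) : EReal)
        ≤ ((branchingFun d φ u - branchingFun d φ (θ * u) - c + c : ℝ) : EReal) :=
          EReal.coe_le_coe_iff.2 (by linarith)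
      _ ≤ A u + c := by
          rw [EReal.coe_add]
          gcongr

lemma tendsto_nhdsLT_one {d : ℝ≥0} (hφ : IsSpectrumProfile d φ) :
    Tendsto φ (𝓝[<] 1) (𝓝 (φ 1)) :=
  (hφ.lipschitz.continuousOn 1 (by simp)).mono_left <|
    nhdsWithin_le_of_mem (mem_of_superset (Ioo_mem_nhdsLT one_pos) Ioo_subset_Ioc_self)

lemma hasScaledLowerSpectrum {d : ℝ≥0} (hφ : IsSpectrumProfile d φ) {X : Type*} [MetricSpace X]
    (h : ∀ θ ∈ Ioo (0 : ℝ) 1, lowerSlope (fun u => lowerCovering X u (θ * u)) = φ θ) :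
    HasScaledLowerSpectrum X φ := by
  have hspec : ∀ θ ∈ Ioo (0 : ℝ) 1,
      ENNReal.ofReal (1 - θ) * lowerSpectrum θ X = ENNReal.ofReal (φ θ) := fun θ hθ => by
    rw [← EReal.coe_ennreal_eq_coe_ennreal_iff, coe_ofReal_mul_lowerSpectrum hθ.2, h θ hθ,
      EReal.coe_ennreal_ofReal, max_eq_left (hφ.nonneg θ (Ioo_subset_Ioc_self hθ))]
  refine ⟨hspec, ((ENNReal.continuous_ofReal.tendsto _).comp hφ.tendsto_nhdsLT_one).congr' ?_⟩
  filter_upwards [Ioo_mem_nhdsLT (one_pos (α := ℝ))] with θ hθ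
  exact (hspec θ hθ).symm

theorem exists_uniform_hasScaledLowerSpectrum {d : ℕ} (hφ : IsSpectrumProfile d φ) :
    ∃ F : Set (EuclideanSpace ℝ (Fin d)),
      F.Nonempty ∧ IsUniformSpaceAtScales F ∧ HasScaledLowerSpectrum F φ := by
  have hmax (v : ℝ) : 0 < max v 1 := lt_max_of_lt_right one_pos
  have hlip (v u : ℝ) (hvu : v ≤ u) :
      branchingFun d φ (max u 1) ≤ branchingFun d φ (max v 1) + d * (u - v) := by
    have hsub : max u 1 ≤ u - v + max v 1 :=
      max_le (by linarith [le_max_left v 1]) (by linarith [le_max_right v 1])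
    refine (hφ.branchingFun_le_add_mul (hmax v) (max_le_max_right 1 hvu)).trans ?_
    rw [NNReal.coe_natCast]
    gcongr _ + _ * ?_
    exact sub_le_iff_le_add.2 hsub
  obtain ⟨F, hF, c, hc⟩ := exists_set_branching_near (d := d)
    (H := fun v => branchingFun d φ (max v 1))
    (fun v u hvu => hφ.branchingFun_mono (hmax v) (max_le_max_right 1 hvu)) hlip
    fun v hv => by rw [max_eq_right (hv.trans zero_le_one), max_eq_right zero_le_one]
  have : Nonempty F := hF.to_subtype
  refine ⟨F, hF, ⟨fun _ => 2 * c, ?_, fun u v huv => ?_⟩, hφ.hasScaledLowerSpectrum fun θ hθ => ?_⟩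
  · simpa using tendsto_inv_atTop_zero.mul_const (2 * c)
  · calc upperBranching F u v
        ≤ ((branchingFun d φ (max u 1) - branchingFun d φ (max v 1) + c : ℝ) : EReal) :=
          (hc u v huv).1
      _ = ((branchingFun d φ (max u 1) - branchingFun d φ (max v 1) - c : ℝ) : EReal) +
            ((2 * c : ℝ) : EReal) := by rw [← EReal.coe_add]; ring_nf
      _ ≤ lowerBranching F u v + ((2 * c : ℝ) : EReal) := add_le_add_left (hc u v huv).2 _
  · have hscales : ∀ᶠ u : ℝ in atTop, θ * u ≤ u ∧ max u 1 = u ∧ max (θ * u) 1 = θ * u := by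
      filter_upwards [eventually_ge_atTop 1,
        (tendsto_id.const_mul_atTop hθ.1).eventually_ge_atTop 1] with u hu hθu
      exact ⟨mul_le_of_le_one_left (zero_le_one.trans hu) hθ.2.le, max_eq_left hu,
        max_eq_left hθu⟩
    refine hφ.lowerSlope_eq (c := c) (Ioo_subset_Ioc_self hθ) ?_ ?_
    · filter_upwards [hscales] with u ⟨hle, hu, hθu⟩
      simpa only [hu, hθu] using (lowerCovering_le_upperBranching u _).trans (hc u _ hle).1
    · filter_upwards [hscales] with u ⟨hle, hu, hθu⟩
      simpa only [hu, hθu] using (hc u _ hle).2.trans (lowerBranching_le_lowerCovering u _)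

end IsSpectrumProfile

end

theorem theoremC (d : ℕ) :
    (∀ φ : ℝ → ℝ, MapsTo φ (Ioc 0 1) (Icc 0 (d : ℝ)) →
      ((∃ F : Set (EuclideanSpace ℝ (Fin d)),
          F.Nonempty ∧ IsUniformSpaceAtScales F ∧ HasScaledLowerSpectrum F φ) ↔
        LipschitzOnWith (d : ℝ≥0) φ (Ioc 0 1) ∧
          ∀ l ∈ Ioc (0 : ℝ) 1, ∀ θ ∈ Ioc (0 : ℝ) 1, φ θ ≤ φ (l * θ) - θ * φ l)) ∧
    (0 < d → classU d ⊂ classH d) := by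
  refine ⟨fun φ hmaps => ⟨?_, fun ⟨hlip, hsup⟩ => ?_⟩, classU_ssubset_classH⟩
  · rintro ⟨F, hF, ⟨η, hη⟩, hspec⟩
    have : Nonempty F := hF.to_subtype
    have hφ : IsSpectrumProfile d φ := hη.isSpectrumProfile hspec
      (fun _ _ huv => upperBranching_le_of_euclidean F huv) fun θ hθ => (hmaps hθ).1
    exact ⟨hφ.lipschitz, hφ.superadd⟩
  · exact IsSpectrumProfile.exists_uniform_hasScaledLowerSpectrum
      ⟨fun θ hθ => (hmaps hθ).1, hlip, hsup⟩
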